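/- Let $\mu,\nu$ be probability distributions on $\mathbb N=\{0,1,2,\dots\}$ with $\mu(1)<1$ and $\nu(0)>0$, whose generating functions $f(s)=\sum_{n} s^n\mu(n)$ and $g(s)=\sum_n s^n\nu(n)$ satisfy $$f(s)=s+c(1-s)^{1+\alpha}\,\ell(1-s),\qquad g(s)=1-d(1-s)^{\alpha}\,k(1-s),\qquad s\in(0,1),$$ for some constants $c,d>0$, $\alpha\in(0,1]$ and some functions $\ell,k:(0,1)\to(0,\infty)$ that are slowly varying at $0$ and satisfy $\ell(x)/k(x)\to1$ as $x\downarrow0$. Assume that $\delta:=\frac{d}{\alpha c}\in(0,1)$, and let $(b_n)$ be a real sequence with $b_n\to\infty$ and $b_n^\alpha\sim n\,\ell(1/b_n)$ as $n\to\infty$. Let $Z_1$ be a Bienaymé–Galton–Watson process with immigration started at $0$, with offspring distribution $\mu$ and immigration distribution $\nu$; that is, $Z_1$ has the law of the solution of the recursion $Z(m)=X(C(m))+Y(m)$, $C(m)=\sum_{0\le j<m}Z(j)$, $m\in\mathbb N$, where $X$ and $Y$ are independent random walks on $\mathbb Z$ started at $0$ with jump distributions $j\mapsto\mu(j+1)$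 on $\{-1,0,1,\dots\}$ and $\nu$, respectively. For every $n\ge1$ let $Z_n$ be a càdlàg process on $[0,\infty)$ with the same law as $\big(Z_1(\lfloor nu\rfloor)/b_n\big)_{u\ge0}$ (for $n=1$ this denotes the rescaled process and not the chain itself). Put $g_t(Z_n):=\sup\{u\in[0,t]:Z_n(u)=0\}$. Then, for every $t>0$ and every sequence $(s_n)$ of nonnegative numbers such that $ns_n\in\mathbb N$ for all $n\geq 1$ and $s_n\to s\in(0,t)$, $$\mathbb P\big(g_t(Z_n)=s_n\big)\;\sim\;\frac1n\cdot\frac{1}{\Gamma(\delta)\,\Gamma(1-\delta)\,s^{\delta}\,(t-s)^{1-\delta}}\qquad\text{as }n\to\infty .$$ -/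

import Mathlib

open MeasureTheory ProbabilityTheory Filter Topology Asymptotics
open scoped NNReal

/-- The probability generating function `s ↦ ∑ₙ sⁿ p(n)` of a distribution `p` on `ℕ`. -/
noncomputable def genFun (p : PMF ℕ) (s : ℝ) : ℝ :=
  ∑' n : ℕ, s ^ n * (p n).toReal

/-- A function on `(0,1)` (values elsewhere are irrelevant) is slowly varying at zero. -/
def SlowlyVaryingAtZero (h : ℝ → ℝ) : Prop :=
  ∀ a : ℝ, 0 < a → Tendsto (fun x => h (a * x) / h x) (𝓝[>] 0) (𝓝 1)

/-- Assumption (SL) on the offspring distribution `μ` and the immigration distribution `ν`, with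
constants `α ∈ (0,1]`, `c, d > 0` and functions `l, k : (0,1) → (0,∞)` slowly varying at zero and
asymptotically equivalent there. -/
structure AssumptionSL (μ ν : PMF ℕ) (α c d : ℝ) (l k : ℝ → ℝ) : Prop where
  c_pos : 0 < c
  d_pos : 0 < d
  α_pos : 0 < α
  α_le_one : α ≤ 1
  l_pos : ∀ x ∈ Set.Ioo (0 : ℝ) 1, 0 < l x
  k_pos : ∀ x ∈ Set.Ioo (0 : ℝ) 1, 0 < k x
  l_slow : SlowlyVaryingAtZero l
  k_slow : SlowlyVaryingAtZero k
  ratio : Tendsto (fun x => l x / k x) (𝓝[>] 0) (𝓝 1)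
  offspring : ∀ s ∈ Set.Ioo (0 : ℝ) 1,
    genFun μ s = s + c * (1 - s) ^ (1 + α) * l (1 - s)
  immigration : ∀ s ∈ Set.Ioo (0 : ℝ) 1,
    genFun ν s = 1 - d * (1 - s) ^ α * k (1 - s)

/-- `W` is, under `P`, a random walk on `ℤ` started at `0` with jump distribution `p`. -/
structure IsRandomWalk {Ω : Type*} [MeasurableSpace Ω] (P : Measure Ω) (p : PMF ℤ)
    (W : Ω → ℕ → ℤ) : Prop where
  measurable : Measurable W
  zero : ∀ᵐ ω ∂P, W ω 0 = 0
  indep : iIndepFun (fun (n : ℕ) (ω : Ω) => W ω (n + 1) - W ω n) P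
  law : ∀ n : ℕ, P.map (fun ω => W ω (n + 1) - W ω n) = p.toMeasure

/-- `Z` solves the discrete Lamperti recursion driven by `X` and `Y`:
`Z = X ∘ C + Y`, where `C(k) = ∑_{0 ≤ j < k} Z(j)`. -/
def SolvesLamperti (X Y : ℕ → ℤ) (Z : ℕ → ℕ) : Prop :=
  ∀ k : ℕ, (Z k : ℤ) = X (∑ j ∈ Finset.range k, Z j) + Y k

/-- `Z` is, under `P`, a Bienaymé–Galton–Watson process with immigration, started at `0`, with
offspring distribution `μ` and immigration distribution `ν`: it has the law of the solution of the
discrete Lamperti recursion driven by independent random walks `X`, `Y` whose jump distributions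
are the shifted offspring distribution `j ↦ μ (j + 1)` on `{-1, 0, 1, …}` and `ν`. -/
def IsBGWI (μ ν : PMF ℕ) {Ω : Type*} [MeasurableSpace Ω] (P : Measure Ω) (Z : Ω → ℕ → ℕ) : Prop :=
  ∃ (Ω' : Type) (_ : MeasurableSpace Ω') (P' : Measure Ω') (X Y : Ω' → ℕ → ℤ) (Z' : Ω' → ℕ → ℕ),
    IsProbabilityMeasure P' ∧
    IsRandomWalk P' (μ.map fun j : ℕ => (j : ℤ) - 1) X ∧
    IsRandomWalk P' (ν.map fun j : ℕ => (j : ℤ)) Y ∧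
    IndepFun X Y P' ∧
    (∀ᵐ ω ∂P', SolvesLamperti (X ω) (Y ω) (Z' ω)) ∧
    IdentDistrib Z Z' P P'

/-- `b` is a scaling sequence associated with `α` and `l`: an asymptotic inverse of
`x ↦ x ^ α / l (1 / x)` at infinity, i.e. `b n → ∞` and `(b n) ^ α ∼ n * l (1 / b n)`. -/
structure IsScalingSequence (α : ℝ) (l : ℝ → ℝ) (b : ℕ → ℝ) : Prop where
  tendsto_atTop : Tendsto b atTop atTop
  equiv : (fun n : ℕ => b n ^ α) ~[atTop] fun n : ℕ => (n : ℝ) * l (1 / b n)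

/-- Right-continuous paths on `[0,∞)` with left limits. -/
def IsCadlagPath (z : ℝ≥0 → ℝ) : Prop :=
  ∀ u : ℝ≥0, ContinuousWithinAt z (Set.Ici u) u ∧ ∃ y : ℝ, Tendsto z (𝓝[<] u) (𝓝 y)

/-- `g_t(z) = sup {u ≤ t : z(u) = 0}`, the last zero of the path `z` before time `t`
(the supremum is taken in `[0,∞)`, so `sup ∅ = 0`). -/
noncomputable def lastZero (t : ℝ≥0) (z : ℝ≥0 → ℝ) : ℝ≥0 :=
  sSup {u : ℝ≥0 | u ≤ t ∧ z u = 0}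

/-!
Write `f`, `g` for the generating functions of `μ`, `ν` and `fⱼ` for the `j`-th iterate of `f`. The
chain regenerates at each visit to `0`, so the probability that its last zero up to time `N` is `m`
factorises as `u m * v (N - m)` with `u m = P(Z m = 0) = ∏_{j < m} g(fⱼ(0))` (`zeroProb`) and `v r`
the probability of avoiding `0` at times `1, …, r` (`avoidProb`). Summing over `m` gives the renewal
equation `∑ u m * v (N - m) = 1`. A zero at time `m` occupies `[m / n, (m + 1) / n)` in rescaled
time, so `g_t = sₙ` means that the last zero of the chain up to time `⌊n t⌋` is `n sₙ - 1`. It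
remains to find the asymptotics of the sequences `u` and `v`.

* The numbers `x j = 1 - fⱼ(0)` satisfy `x (j + 1) = x j - φ (x j)` with `φ` convex and regularly
  varying of index `1 + α`. Convexity lets the increments of `φ` inherit the regular variation, so
  `x / φ x` grows by asymptotically `α` at each step, and Cesàro means give `j φ(x j) / x j → 1 / α`
  (`tendsto_mul_drift_div_self`). Hence `1 - g(fⱼ(0)) ∼ δ / j`, and `u` is regularly varying of
  index `-δ` (`AssumptionSL.normalizedRegVar_zeroProb`).
* Karamata's Abelian theorem (`NormalizedRegVar.tendsto_genFun`) and the renewal equation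
  `U(r) V(r) = 1 / (1 - r)` give the behaviour at `1` of the generating function `V` of `v`.
* Since `v` is monotone, a Tauberian theorem returns from `V` to `v`
  (`tendsto_of_tendsto_genFun_ratio`): the measures with weights proportional to `v k * r ^ k` at the
  points `r ^ k` have converging moments, so `k (1 - r)` converges in law to a gamma variable, and
  monotonicity of the weights upgrades this to convergence of densities.

The slowly varying factors of `u m` and `v (N - m)` cancel in the product
(`tendsto_mul_of_renewal`), which leaves the generalised arcsine density.
-/

/-! ### Iterating a convex, regularly varying drift -/

lemma ConvexOn.monotoneOn_div_self {φ : ℝ → ℝ} (hc : ConvexOn ℝ (Set.Icc 0 1) φ) (h0 : φ 0 = 0) :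
    MonotoneOn (fun x => φ x / x) (Set.Ioc 0 1) := by
  intro x hx y hy hxy
  have := hc.secant_mono (a := 0) (x := x) (y := y) (by simp) ⟨hx.1.le, hx.2⟩ ⟨hy.1.le, hy.2⟩
    hx.1.ne' hy.1.ne' hxy
  simpa [h0] using this

lemma tendsto_div_self_of_regularlyVarying {φ : ℝ → ℝ} {α : ℝ} (hα : 0 < α)
    (hc : ConvexOn ℝ (Set.Icc 0 1) φ) (h0 : φ 0 = 0) (hpos : ∀ x ∈ Set.Ioc (0 : ℝ) 1, 0 < φ x)
    (hrv : ∀ a : ℝ, 0 < a → Tendsto (fun x => φ (a * x) / φ x) (𝓝[>] 0) (𝓝 (a ^ (1 + α)))) :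
    Tendsto (fun x => φ x / x) (𝓝[>] 0) (𝓝 0) := by
  have hm := (hc.monotoneOn_div_self h0).mono (Set.Ioo_subset_Ioc_self)
  have hlim := hm.tendsto_nhdsWithin_Ioo_right (by simp)
    ⟨0, by rintro _ ⟨x, hx, rfl⟩; exact (div_pos (hpos x ⟨hx.1, hx.2.le⟩) hx.1).le⟩
  set L := sInf ((fun x => φ x / x) '' Set.Ioo 0 1) with hL
  by_cases hL0 : L = 0
  · rwa [hL0] at hlim
  exfalso
  -- A nonzero limit would force the regular variation index of `φ` to be `1`.
  have h2 : Tendsto (fun x : ℝ => 2 * x) (𝓝[>] 0) (𝓝[>] 0) := by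
    refine tendsto_nhdsWithin_iff.2 ⟨?_, ?_⟩
    · have : Tendsto (fun x : ℝ => 2 * x) (𝓝 0) (𝓝 (2 * 0)) := tendsto_id.const_mul 2
      rw [mul_zero] at this
      exact this.mono_left nhdsWithin_le_nhds
    · filter_upwards [self_mem_nhdsWithin] with x hx
      simpa using hx
  have hr := (hlim.comp h2).div hlim hL0
  rw [div_self hL0] at hr
  have hr' := (hrv 2 two_pos).div_const 2
  have := tendsto_nhds_unique hr (hr'.congr' (by
    filter_upwards [self_mem_nhdsWithin] with x hx
    have : x ≠ 0 := (Set.mem_Ioi.1 hx).ne'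
    simp only [Pi.div_apply, Function.comp]
    by_cases hφ : φ x = 0
    · simp [hφ]
    · field_simp))
  have h3 : (2 : ℝ) ^ (1 : ℝ) < 2 ^ (1 + α) :=
    Real.rpow_lt_rpow_of_exponent_lt (by norm_num) (by linarith)
  rw [Real.rpow_one] at h3
  linarith

/-- Convexity turns regular variation of `φ` into regular variation of its increments: over the
short interval `[x - φ x, x]` the slope of `φ` is equivalent to `(1 + α) φ x / x`. -/
lemma tendsto_slope_of_regularlyVarying {φ : ℝ → ℝ} {α : ℝ} (hα : 0 < α)
    (hc : ConvexOn ℝ (Set.Icc 0 1) φ) (h0 : φ 0 = 0) (hpos : ∀ x ∈ Set.Ioc (0 : ℝ) 1, 0 < φ x)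
    (hrv : ∀ a : ℝ, 0 < a → Tendsto (fun x => φ (a * x) / φ x) (𝓝[>] 0) (𝓝 (a ^ (1 + α)))) :
    Tendsto (fun x => x * (φ x - φ (x - φ x)) / φ x ^ 2) (𝓝[>] 0) (𝓝 (1 + α)) := by
  have hder : HasDerivAt (fun a : ℝ => a ^ (1 + α)) (1 + α) 1 := by
    simpa using Real.hasDerivAt_rpow_const (x := 1) (p := 1 + α) (Or.inl one_ne_zero)
  have hsl := hasDerivAt_iff_tendsto_slope.1 hder
  have hψ := tendsto_div_self_of_regularlyVarying hα hc h0 hpos hrv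
  have hsmall : ∀ᶠ x in 𝓝[>] (0 : ℝ), x ∈ Set.Ioo (0 : ℝ) (1 / 2) := Ioo_mem_nhdsGT (by norm_num)
  have hlim : ∀ a : ℝ, 0 < a → Tendsto (fun x => (φ (a * x) / φ x - 1) / (a - 1)) (𝓝[>] 0)
      (𝓝 (slope (fun a : ℝ => a ^ (1 + α)) 1 a)) := by
    intro a ha
    have := ((hrv a ha).sub_const 1).div_const (a - 1)
    rwa [slope_def_field, Real.one_rpow]
  -- By convexity the slope over `[x - φ x, x]` lies between the slopes over `[a x, x]` for `a < 1`
  -- and over `[x, a x]` for `a > 1`; then `a → 1`.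
  refine tendsto_order.2 ⟨fun b hb => ?_, fun b hb => ?_⟩
  · have h1 : ∀ᶠ a in 𝓝[<] (1 : ℝ), b < slope (fun a : ℝ => a ^ (1 + α)) 1 a :=
      (hsl.mono_left (nhdsWithin_mono _ fun a ha => (Set.mem_Iio.1 ha).ne)).eventually_const_lt hb
    obtain ⟨a, hab, ha⟩ := (h1.and (Ioo_mem_nhdsLT (show (1 / 2 : ℝ) < 1 by norm_num))).exists
    filter_upwards [hsmall, (hlim a (by linarith [ha.1])).eventually_const_lt hab,
      hψ.eventually_lt_const (show 0 < 1 - a by linarith [ha.2])] with x hx hbx hxψ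
    refine hbx.trans_le ?_
    have hφ := hpos x ⟨hx.1, by linarith [hx.2]⟩
    rw [div_lt_iff₀ hx.1] at hxψ
    have ha0 : 0 < a := by linarith [ha.1]
    have hax := mul_pos ha0 hx.1
    have hax' : a * x < x := by nlinarith [ha.2, hx.1]
    have hx1 : x ∈ Set.Icc (0 : ℝ) 1 := ⟨hx.1.le, by linarith [hx.2]⟩
    have := hc.secant_mono (a := x) (x := a * x) (y := x - φ x) hx1
      ⟨hax.le, by linarith [hx.2]⟩ ⟨by nlinarith, by linarith [hx.2]⟩ hax'.ne (by linarith)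
      (by nlinarith)
    have e1 : x * (φ x - φ (x - φ x)) / φ x ^ 2
        = x / φ x * ((φ (x - φ x) - φ x) / (x - φ x - x)) := by
      rw [show x - φ x - x = -φ x by ring]; field_simp; ring
    have hne : a - 1 ≠ 0 := by linarith [ha.2]
    have e2 : (φ (a * x) / φ x - 1) / (a - 1) = x / φ x * ((φ (a * x) - φ x) / (a * x - x)) := by
      have := hx.1.ne'
      rw [show a * x - x = (a - 1) * x by ring]; field_simp
    rw [e1, e2]
    exact mul_le_mul_of_nonneg_left this (div_pos hx.1 hφ).le
  · have h1 : ∀ᶠ a in 𝓝[>] (1 : ℝ), slope (fun a : ℝ => a ^ (1 + α)) 1 a < b :=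
      (hsl.mono_left (nhdsWithin_mono _ fun a ha => (Set.mem_Ioi.1 ha).ne')).eventually_lt_const hb
    obtain ⟨a, hab, ha⟩ := (h1.and (Ioo_mem_nhdsGT (show (1 : ℝ) < 2 by norm_num))).exists
    filter_upwards [hsmall, (hlim a (by linarith [ha.1])).eventually_lt_const hab,
      hψ.eventually_lt_const one_pos] with x hx hbx hxψ
    refine lt_of_le_of_lt ?_ hbx
    have hφ := hpos x ⟨hx.1, by linarith [hx.2]⟩
    rw [div_lt_iff₀ hx.1] at hxψ
    have ha0 : 0 < a := by linarith [ha.1]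
    have hax := mul_pos ha0 hx.1
    have hax' : x < a * x := by nlinarith [ha.1, hx.1]
    have hx1 : x ∈ Set.Icc (0 : ℝ) 1 := ⟨hx.1.le, by linarith [hx.2]⟩
    have := hc.secant_mono (a := x) (x := x - φ x) (y := a * x) hx1
      ⟨by linarith, by linarith [hx.2]⟩ ⟨hax.le, by nlinarith [ha.2, hx.2, hx.1]⟩
      (by linarith) hax'.ne' (by linarith)
    have e1 : x * (φ x - φ (x - φ x)) / φ x ^ 2
        = x / φ x * ((φ (x - φ x) - φ x) / (x - φ x - x)) := by
      rw [show x - φ x - x = -φ x by ring]; field_simp; ring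
    have hne : a - 1 ≠ 0 := by linarith [ha.1]
    have e2 : (φ (a * x) / φ x - 1) / (a - 1) = x / φ x * ((φ (a * x) - φ x) / (a * x - x)) := by
      have := hx.1.ne'
      rw [show a * x - x = (a - 1) * x by ring]; field_simp
    rw [e1, e2]
    exact mul_le_mul_of_nonneg_left this (div_pos hx.1 hφ).le

/-- One step `x ↦ x - φ x` increases `x / φ x` by asymptotically `α`. -/
lemma tendsto_div_sub_div_of_regularlyVarying {φ : ℝ → ℝ} {α : ℝ} (hα : 0 < α)
    (hc : ConvexOn ℝ (Set.Icc 0 1) φ) (h0 : φ 0 = 0) (hpos : ∀ x ∈ Set.Ioc (0 : ℝ) 1, 0 < φ x)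
    (hrv : ∀ a : ℝ, 0 < a → Tendsto (fun x => φ (a * x) / φ x) (𝓝[>] 0) (𝓝 (a ^ (1 + α)))) :
    Tendsto (fun x => (x - φ x) / φ (x - φ x) - x / φ x) (𝓝[>] 0) (𝓝 α) := by
  have hψ := tendsto_div_self_of_regularlyVarying hα hc h0 hpos hrv
  have hR := tendsto_slope_of_regularlyVarying hα hc h0 hpos hrv
  have h1 : Tendsto (fun x => 1 - x * (φ x - φ (x - φ x)) / φ x ^ 2 * (φ x / x)) (𝓝[>] 0)
      (𝓝 1) := by simpa using (hR.mul hψ).const_sub 1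
  have h2 := (hR.sub_const 1).div h1 one_ne_zero
  rw [show (1 + α - 1) / 1 = α by ring] at h2
  refine h2.congr' ?_
  filter_upwards [Ioo_mem_nhdsGT (show (0 : ℝ) < 1 by norm_num), hψ.eventually_lt_const one_pos]
    with x hx hxψ
  have hφ := hpos x ⟨hx.1, hx.2.le⟩
  rw [div_lt_iff₀ hx.1] at hxψ
  have hφy := hpos (x - φ x) ⟨by linarith, by linarith [hx.2]⟩
  have hx0 := hx.1.ne'
  have : 1 - x * (φ x - φ (x - φ x)) / φ x ^ 2 * (φ x / x) = φ (x - φ x) / φ x := by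
    field_simp; ring
  simp only [Pi.div_apply]
  rw [this]
  field_simp
  ring

lemma tendsto_zero_of_sub_drift {φ : ℝ → ℝ}
    (hc : ConvexOn ℝ (Set.Icc 0 1) φ) (h0 : φ 0 = 0) (hpos : ∀ x ∈ Set.Ioc (0 : ℝ) 1, 0 < φ x)
    {x : ℕ → ℝ} (hx : ∀ j, x j ∈ Set.Ioc (0 : ℝ) 1) (hrec : ∀ j, x (j + 1) = x j - φ (x j)) :
    Tendsto x atTop (𝓝[>] 0) := by
  have hanti : Antitone x := antitone_nat_of_succ_le fun j => by
    rw [hrec]; linarith [hpos _ (hx j)]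
  have hlim := tendsto_atTop_ciInf hanti ⟨0, by rintro _ ⟨j, rfl⟩; exact (hx j).1.le⟩
  set L := ⨅ j, x j
  have hLx : ∀ j, L ≤ x j := fun j => ciInf_le ⟨0, by rintro _ ⟨j, rfl⟩; exact (hx j).1.le⟩ j
  have hL0 : 0 ≤ L := le_ciInf fun j => (hx j).1.le
  rcases hL0.eq_or_lt with hL | hL
  · rw [← hL] at hlim
    exact tendsto_nhdsWithin_iff.2 ⟨hlim, Eventually.of_forall fun j => (hx j).1⟩
  exfalso
  have hLm : L ∈ Set.Ioc (0 : ℝ) 1 := ⟨hL, (hLx 0).trans (hx 0).2⟩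
  have hφL := hpos L hLm
  have hlb : ∀ j, φ L ≤ φ (x j) := fun j => by
    have h1 := hc.monotoneOn_div_self h0 hLm (hx j) (hLx j)
    simp only at h1
    rw [div_le_div_iff₀ hL (hx j).1] at h1
    have := mul_le_mul_of_nonneg_left (hLx j) hφL.le
    exact le_of_mul_le_mul_right (this.trans h1) hL
  have h1 : Tendsto (fun j => x j - x (j + 1)) atTop (𝓝 (L - L)) :=
    hlim.sub (hlim.comp (tendsto_add_atTop_nat 1))
  rw [sub_self] at h1
  have := ge_of_tendsto' h1 (b := φ L) fun j => by rw [hrec]; linarith [hlb j]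
  linarith

/-- The iterates of `x ↦ x - φ x` decrease to `0` at the rate `φ (x j) / x j ∼ 1 / (α j)`. -/
lemma tendsto_mul_drift_div_self {φ : ℝ → ℝ} {α : ℝ} (hα : 0 < α)
    (hc : ConvexOn ℝ (Set.Icc 0 1) φ) (h0 : φ 0 = 0) (hpos : ∀ x ∈ Set.Ioc (0 : ℝ) 1, 0 < φ x)
    (hrv : ∀ a : ℝ, 0 < a → Tendsto (fun x => φ (a * x) / φ x) (𝓝[>] 0) (𝓝 (a ^ (1 + α))))
    {x : ℕ → ℝ} (hx : ∀ j, x j ∈ Set.Ioc (0 : ℝ) 1) (hrec : ∀ j, x (j + 1) = x j - φ (x j)) :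
    Tendsto (fun j : ℕ => (j : ℝ) * (φ (x j) / x j)) atTop (𝓝 (1 / α)) := by
  have h1 := (tendsto_div_sub_div_of_regularlyVarying hα hc h0 hpos hrv).comp
    (tendsto_zero_of_sub_drift hc h0 hpos hx hrec)
  have h2 := h1.cesaro
  have h3 : ∀ n : ℕ, ∑ i ∈ Finset.range n,
      ((fun x => (x - φ x) / φ (x - φ x) - x / φ x) ∘ x) i
      = x n / φ (x n) - x 0 / φ (x 0) := by
    intro n
    rw [← Finset.sum_range_sub (fun i => x i / φ (x i))]
    exact Finset.sum_congr rfl fun i _ => by simp [hrec]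
  simp_rw [h3] at h2
  have h4 : Tendsto (fun n : ℕ => (n : ℝ)⁻¹ * (x 0 / φ (x 0))) atTop (𝓝 0) := by
    simpa using (tendsto_inv_atTop_nhds_zero_nat (𝕜 := ℝ)).mul_const (x 0 / φ (x 0))
  have h5 := (h2.add h4).inv₀ (by simpa using hα.ne')
  rw [add_zero, ← one_div] at h5
  refine h5.congr fun n => ?_
  rw [← mul_add, sub_add_cancel, mul_inv, inv_inv, inv_div]

/-! ### Generating functions and their iterates -/

lemma PMF.summable_toReal (p : PMF ℕ) : Summable fun n => (p n).toReal :=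
  ENNReal.summable_toReal (by simp [p.tsum_coe])

lemma summable_genFun (p : PMF ℕ) {s : ℝ} (hs : s ∈ Set.Icc (0 : ℝ) 1) :
    Summable fun n : ℕ => s ^ n * (p n).toReal :=
  p.summable_toReal.of_nonneg_of_le (fun n => by have := hs.1; positivity) fun n =>
    mul_le_of_le_one_left ENNReal.toReal_nonneg (pow_le_one₀ hs.1 hs.2)

lemma genFun_one (p : PMF ℕ) : genFun p 1 = 1 := by
  simp only [genFun, one_pow, one_mul]
  rw [← ENNReal.tsum_toReal_eq fun n => p.apply_ne_top n, p.tsum_coe, ENNReal.toReal_one]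

lemma genFun_zero (p : PMF ℕ) : genFun p 0 = (p 0).toReal := by
  rw [genFun, tsum_eq_single 0 fun n hn => by simp [hn]]
  simp

lemma genFun_mono (p : PMF ℕ) : MonotoneOn (genFun p) (Set.Icc 0 1) := fun s hs t ht hst =>
  (summable_genFun p hs).tsum_le_tsum (fun n => by have := hs.1; gcongr) (summable_genFun p ht)

lemma convexOn_genFun (p : PMF ℕ) : ConvexOn ℝ (Set.Icc 0 1) (genFun p) := by
  refine ⟨convex_Icc 0 1, fun s hs t ht a b ha hb hab => ?_⟩
  have hst := convex_Icc (0 : ℝ) 1 hs ht ha hb hab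
  simp only [genFun, smul_eq_mul]
  rw [← tsum_mul_left, ← tsum_mul_left, ← ((summable_genFun p hs).mul_left a).tsum_add
    ((summable_genFun p ht).mul_left b)]
  refine (summable_genFun p hst).tsum_le_tsum (fun n => ?_)
    (((summable_genFun p hs).mul_left a).add ((summable_genFun p ht).mul_left b))
  have := (convexOn_pow (𝕜 := ℝ) n).2 hs.1 ht.1 ha hb hab
  simp only [smul_eq_mul] at this
  rw [← mul_assoc, ← mul_assoc, ← add_mul]
  exact mul_le_mul_of_nonneg_right this ENNReal.toReal_nonneg

lemma genFun_mem_Icc (p : PMF ℕ) {s : ℝ} (hs : s ∈ Set.Icc (0 : ℝ) 1) :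
    genFun p s ∈ Set.Icc (p 0).toReal 1 := by
  constructor
  · rw [← genFun_zero]
    exact genFun_mono p (by simp) hs hs.1
  · rw [← genFun_one p]
    exact genFun_mono p hs (by simp) hs.2

/-- The drift `x ↦ f (1 - x) - (1 - x)` of the iteration `x ↦ 1 - f (1 - x)` inherits convexity,
positivity and regular variation with index `1 + α` from the offspring generating function `f`. -/
lemma AssumptionSL.drift {μ ν : PMF ℕ} {α c d : ℝ} {l k : ℝ → ℝ}
    (h : AssumptionSL μ ν α c d l k) :
    let φ : ℝ → ℝ := fun x => genFun μ (1 - x) - (1 - x)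
    ConvexOn ℝ (Set.Icc 0 1) φ ∧ φ 0 = 0 ∧ (∀ x ∈ Set.Ioc (0 : ℝ) 1, 0 < φ x) ∧
      (∀ a : ℝ, 0 < a → Tendsto (fun x => φ (a * x) / φ x) (𝓝[>] 0) (𝓝 (a ^ (1 + α)))) := by
  intro φ
  have hφ : ∀ x ∈ Set.Ioo (0 : ℝ) 1, φ x = c * x ^ (1 + α) * l x := fun x hx => by
    have := h.offspring (1 - x) ⟨by linarith [hx.2], by linarith [hx.1]⟩
    simp only [φ, this, sub_sub_cancel]; ring
  have hc : ConvexOn ℝ (Set.Icc 0 1) φ := by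
    refine ⟨convex_Icc 0 1, fun s hs t ht a b ha hb hab => ?_⟩
    have := (convexOn_genFun μ).2 (x := 1 - s) (y := 1 - t) ⟨by linarith [hs.2], by linarith [hs.1]⟩
      ⟨by linarith [ht.2], by linarith [ht.1]⟩ ha hb hab
    simp only [smul_eq_mul] at this ⊢
    have e : a * (1 - s) + b * (1 - t) = 1 - (a * s + b * t) := by linear_combination hab
    rw [e] at this
    simp only [φ]
    linear_combination this + hab
  have h0 : φ 0 = 0 := by simp [φ, genFun_one]
  have hposo : ∀ x ∈ Set.Ioo (0 : ℝ) 1, 0 < φ x := fun x hx => by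
    rw [hφ x hx]
    exact mul_pos (mul_pos h.c_pos (Real.rpow_pos_of_pos hx.1 _)) (h.l_pos x hx)
  have hpos : ∀ x ∈ Set.Ioc (0 : ℝ) 1, 0 < φ x := fun x hx => by
    rcases hx.2.eq_or_lt with h1 | h1
    · have h2 := hc.monotoneOn_div_self h0 (a := 1 / 2) (b := x) ⟨by norm_num, by norm_num⟩ hx
        (by rw [h1]; norm_num)
      have h3 := hposo (1 / 2) ⟨by norm_num, by norm_num⟩
      have h4 := (div_pos h3 (by norm_num : (0 : ℝ) < 1 / 2)).trans_le h2
      simp only [h1, div_one] at h4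
      rwa [h1]
    · exact hposo x ⟨hx.1, h1⟩
  refine ⟨hc, h0, hpos, fun a ha => ?_⟩
  have h1 := (h.l_slow a ha).const_mul (a ^ (1 + α))
  rw [mul_one] at h1
  refine h1.congr' ?_
  have hmem : ∀ᶠ x in 𝓝[>] (0 : ℝ), x ∈ Set.Ioo (0 : ℝ) (min 1 (1 / a)) :=
    Ioo_mem_nhdsGT (by positivity)
  filter_upwards [hmem] with x hx
  have hx1 : x ∈ Set.Ioo (0 : ℝ) 1 := ⟨hx.1, hx.2.trans_le (min_le_left _ _)⟩
  have hx2 : a * x < 1 := by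
    have := hx.2.trans_le (min_le_right _ _)
    rw [lt_div_iff₀ ha] at this
    linarith
  rw [hφ x hx1, hφ (a * x) ⟨mul_pos ha hx.1, hx2⟩, Real.mul_rpow ha.le hx.1.le]
  have := Real.rpow_pos_of_pos hx.1 (1 + α)
  have := h.l_pos x hx1
  have := h.c_pos
  field_simp

lemma AssumptionSL.offspring_zero_lt_one {μ ν : PMF ℕ} {α c d : ℝ} {l k : ℝ → ℝ}
    (h : AssumptionSL μ ν α c d l k) : (μ 0).toReal < 1 := by
  obtain ⟨hc, h0, hpos, hrv⟩ := h.drift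
  have hψ := tendsto_div_self_of_regularlyVarying h.α_pos hc h0 hpos hrv
  by_contra! hcon
  obtain ⟨x, hx, hxm⟩ := ((hψ.eventually_lt_const one_pos).and
    (Ioo_mem_nhdsGT (show (0 : ℝ) < 1 by norm_num))).exists
  have h1 := (genFun_mem_Icc μ (s := 1 - x) ⟨by linarith [hxm.2], by linarith [hxm.1]⟩).1
  rw [div_lt_one hxm.1] at hx
  linarith

/-- `1 - fⱼ(0)`, the probability that a critical branching process survives `j` generations, stays
in `(0, 1]`. -/
lemma AssumptionSL.one_sub_iterate_mem {μ ν : PMF ℕ} {α c d : ℝ} {l k : ℝ → ℝ}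
    (h : AssumptionSL μ ν α c d l k) (j : ℕ) : 1 - (genFun μ)^[j] 0 ∈ Set.Ioc (0 : ℝ) 1 := by
  induction j with
  | zero => simp
  | succ j ih =>
    rw [Function.iterate_succ_apply']
    set s := (genFun μ)^[j] 0
    have hs : s ∈ Set.Icc (0 : ℝ) 1 := ⟨by linarith [ih.2], by linarith [ih.1]⟩
    have h1 := genFun_mem_Icc μ hs
    refine ⟨?_, by linarith [h1.1, ENNReal.toReal_nonneg (a := μ 0)]⟩
    have := (convexOn_genFun μ).2 (show (0 : ℝ) ∈ Set.Icc (0 : ℝ) 1 by simp)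
      (show (1 : ℝ) ∈ Set.Icc (0 : ℝ) 1 by simp) ih.1.le hs.1 (sub_add_cancel 1 s)
    simp only [smul_eq_mul, mul_zero, mul_one, zero_add, genFun_zero, genFun_one] at this
    nlinarith [h.offspring_zero_lt_one, ih.1]

lemma AssumptionSL.iterate_mem {μ ν : PMF ℕ} {α c d : ℝ} {l k : ℝ → ℝ}
    (h : AssumptionSL μ ν α c d l k) (j : ℕ) : (genFun μ)^[j] 0 ∈ Set.Icc (0 : ℝ) 1 := by
  have := h.one_sub_iterate_mem j
  exact ⟨by linarith [this.2], by linarith [this.1]⟩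

/-- The defect of the `j`-th factor `g (fⱼ(0))` of `P(Z m = 0) = ∏ g (fⱼ(0))` is `∼ δ / j`. -/
lemma AssumptionSL.tendsto_mul_one_sub_genFun_iterate {μ ν : PMF ℕ} {α c d : ℝ} {l k : ℝ → ℝ}
    (h : AssumptionSL μ ν α c d l k) :
    Tendsto (fun j : ℕ => (j : ℝ) * (1 - genFun ν ((genFun μ)^[j] 0))) atTop
      (𝓝 (d / (α * c))) := by
  obtain ⟨hc, h0, hpos, hrv⟩ := h.drift
  obtain ⟨x, hxdef⟩ : ∃ x : ℕ → ℝ, x = fun j => 1 - (genFun μ)^[j] 0 := ⟨_, rfl⟩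
  have hxm : ∀ j, x j ∈ Set.Ioc (0 : ℝ) 1 := fun j => by
    rw [hxdef]; exact h.one_sub_iterate_mem j
  have hrec : ∀ j, x (j + 1) = x j - (genFun μ (1 - x j) - (1 - x j)) := fun j => by
    simp only [hxdef, Function.iterate_succ_apply', sub_sub_cancel]; ring
  have hx0 := tendsto_zero_of_sub_drift hc h0 hpos hxm hrec
  have h1 := tendsto_mul_drift_div_self h.α_pos hc h0 hpos hrv hxm hrec
  have h2 := (h.ratio.comp hx0).inv₀ one_ne_zero
  have h3 := (h1.mul h2).const_mul (d / c)
  have hα := h.α_pos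
  have hcp := h.c_pos
  rw [show d / c * (1 / α * 1⁻¹) = d / (α * c) by field_simp] at h3
  refine h3.congr' ?_
  filter_upwards [hx0 (Ioo_mem_nhdsGT (show (0 : ℝ) < 1 by norm_num))] with j hj
  have hj : x j ∈ Set.Ioo (0 : ℝ) 1 := hj
  have hs : (genFun μ)^[j] 0 = 1 - x j := by simp [hxdef]
  have e1 := h.offspring (1 - x j) ⟨by linarith [hj.2], by linarith [hj.1]⟩
  have e2 := h.immigration (1 - x j) ⟨by linarith [hj.2], by linarith [hj.1]⟩
  rw [sub_sub_cancel] at e1 e2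
  have := h.l_pos _ hj
  have := h.k_pos _ hj
  have := hj.1
  rw [hs, e2]
  simp only [Function.comp, e1, Real.rpow_add hj.1, Real.rpow_one]
  field_simp
  ring

/-! ### Normalised regularly varying sequences and their generating functions -/

/-- `u` is a normalised regularly varying sequence of index `ρ`: up to a relative error that
vanishes as `m → ∞`, `log (u n / u m)` is `ρ * log (n / m)`. -/
def NormalizedRegVar (u : ℕ → ℝ) (ρ : ℝ) : Prop :=
  ∀ ε : ℝ, 0 < ε → ∃ M : ℕ, 1 ≤ M ∧ ∀ m n : ℕ, M ≤ m → m ≤ n →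
    |Real.log (u n) - Real.log (u m) - ρ * (Real.log n - Real.log m)|
      ≤ ε * (Real.log n - Real.log m)

lemma tendsto_mul_log_succ_sub_log :
    Tendsto (fun n : ℕ => (n : ℝ) * (Real.log (n + 1 : ℕ) - Real.log n)) atTop (𝓝 1) := by
  have h1 : Tendsto (fun n : ℕ => (n : ℝ) / (n + 1)) atTop (𝓝 1) :=
    tendsto_natCast_div_add_atTop (1 : ℝ)
  refine tendsto_of_tendsto_of_tendsto_of_le_of_le' h1 tendsto_const_nhds ?_ ?_
  all_goals
    filter_upwards [eventually_ge_atTop 1] with n hn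
    have hn0 : (0 : ℝ) < n := by exact_mod_cast hn
    rw [← Real.log_div (by positivity) hn0.ne']
    push_cast
  · have := Real.one_sub_inv_le_log_of_pos (show (0 : ℝ) < (n + 1) / n by positivity)
    calc (n : ℝ) / (n + 1) = n * (1 - ((n + 1) / n : ℝ)⁻¹) := by field_simp; ring
      _ ≤ _ := by gcongr
  · have := Real.log_le_sub_one_of_pos (show (0 : ℝ) < (n + 1) / n by positivity)
    calc (n : ℝ) * Real.log ((n + 1) / n) ≤ n * ((n + 1) / n - 1) := by gcongr
      _ = 1 := by field_simp; ring

lemma normalizedRegVar_of_tendsto {u q : ℕ → ℝ} {δ : ℝ} (hu : ∀ n, 0 < u n)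
    (hq : ∀ n, 0 < q n) (hrec : ∀ n, u (n + 1) = u n * q n)
    (hlim : Tendsto (fun n : ℕ => (n : ℝ) * (1 - q n)) atTop (𝓝 δ)) :
    NormalizedRegVar u (-δ) := by
  have hq1 : Tendsto q atTop (𝓝 1) := by
    have h1 := (hlim.mul (tendsto_inv_atTop_nhds_zero_nat (𝕜 := ℝ))).const_sub 1
    rw [mul_zero, sub_zero] at h1
    refine h1.congr' ?_
    filter_upwards [eventually_ge_atTop 1] with n hn
    have : (n : ℝ) ≠ 0 := by positivity
    field_simp; ring
  have hlog : Tendsto (fun n : ℕ => (n : ℝ) * Real.log (q n)) atTop (𝓝 (-δ)) := by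
    have h1 := (hlim.neg).div hq1 one_ne_zero
    rw [div_one] at h1
    refine tendsto_of_tendsto_of_tendsto_of_le_of_le h1 hlim.neg (fun n => ?_) (fun n => ?_)
    · have := Real.one_sub_inv_le_log_of_pos (hq n)
      have hqn := (hq n).ne'
      calc -((n : ℝ) * (1 - q n)) / q n = n * (1 - (q n)⁻¹) := by field_simp; ring
        _ ≤ _ := by gcongr
    · have := Real.log_le_sub_one_of_pos (hq n)
      calc (n : ℝ) * Real.log (q n) ≤ n * (q n - 1) := by gcongr
        _ = _ := by ring
  intro ε hε
  have hone := tendsto_mul_log_succ_sub_log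
  have hd := (hlog.sub (hone.const_mul (-δ))).abs
  have he := hone.const_mul ε
  have hev := hd.eventually_lt he (by simpa using hε)
  obtain ⟨M, hM⟩ := eventually_atTop.1 hev
  have hstep : ∀ n, max M 1 ≤ n →
      |Real.log (q n) - -δ * (Real.log (n + 1 : ℕ) - Real.log n)|
        ≤ ε * (Real.log (n + 1 : ℕ) - Real.log n) := by
    intro n hn
    have hn0 : (0 : ℝ) < n := by exact_mod_cast (le_max_right M 1).trans hn
    have h1 := (hM n ((le_max_left _ _).trans hn)).le
    rw [show (n : ℝ) * Real.log (q n) - -δ * (n * (Real.log (n + 1 : ℕ) - Real.log n))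
      = n * (Real.log (q n) - -δ * (Real.log (n + 1 : ℕ) - Real.log n)) by ring,
      abs_mul, abs_of_pos hn0, show ε * (n * (Real.log (n + 1 : ℕ) - Real.log n))
      = n * (ε * (Real.log (n + 1 : ℕ) - Real.log n)) by ring] at h1
    exact le_of_mul_le_mul_left h1 hn0
  refine ⟨max M 1, le_max_right _ _, fun m n hm hmn => ?_⟩
  induction n, hmn using Nat.le_induction with
  | base => simp
  | succ n hn ih =>
    have h1 := hstep n (hm.trans hn)
    have h2 := (abs_add_le _ _).trans (add_le_add ih h1)
    rw [hrec, Real.log_mul (hu n).ne' (hq n).ne']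
    convert! h2 using 1
    · congr 1; ring
    · ring

lemma NormalizedRegVar.tendsto_div {u : ℕ → ℝ} {ρ : ℝ} (h : NormalizedRegVar u ρ)
    (hu : ∀ n, 0 < u n) {ι : Type*} {L : Filter ι} {m n : ι → ℕ} (hm : Tendsto m L atTop)
    (hn : Tendsto n L atTop) {x : ℝ} (hx : 0 < x)
    (hmn : Tendsto (fun i => (m i : ℝ) / n i) L (𝓝 x)) :
    Tendsto (fun i => u (m i) / u (n i)) L (𝓝 (x ^ ρ)) := by
  have hpos : ∀ᶠ i in L, (0 : ℝ) < m i ∧ (0 : ℝ) < n i := by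
    filter_upwards [hm.eventually_ge_atTop 1, hn.eventually_ge_atTop 1] with i h1 h2
    exact ⟨by exact_mod_cast h1, by exact_mod_cast h2⟩
  have hlog : Tendsto (fun i => Real.log (m i) - Real.log (n i)) L (𝓝 (Real.log x)) := by
    refine ((Real.continuousAt_log hx.ne').tendsto.comp hmn).congr' ?_
    filter_upwards [hpos] with i hi
    simp [Real.log_div hi.1.ne' hi.2.ne']
  have hsymm : ∀ ε : ℝ, 0 < ε → ∃ M : ℕ, ∀ m n : ℕ, M ≤ m → M ≤ n →
      |Real.log (u m) - Real.log (u n) - ρ * (Real.log m - Real.log n)|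
        ≤ ε * |Real.log m - Real.log n| := by
    intro ε hε
    obtain ⟨M, -, hM⟩ := h ε hε
    refine ⟨M, fun m n hm hn => ?_⟩
    rcases le_total n m with hnm | hnm
    · exact (hM n m hn hnm).trans (by gcongr; exact le_abs_self _)
    · have := (hM m n hm hnm).trans (mul_le_mul_of_nonneg_left (le_abs_self _) hε.le)
      rw [abs_sub_comm (Real.log m)]
      refine le_trans (le_of_eq ?_) this
      rw [← abs_neg]; congr 1; ring
  have hdiff : Tendsto (fun i => Real.log (u (m i)) - Real.log (u (n i))
      - ρ * (Real.log (m i) - Real.log (n i))) L (𝓝 0) := by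
    rw [Metric.tendsto_nhds]
    intro η hη
    obtain ⟨M, hM⟩ := hsymm (η / (|Real.log x| + 1)) (by positivity)
    filter_upwards [hm.eventually_ge_atTop M, hn.eventually_ge_atTop M,
      hlog.abs.eventually_lt_const (lt_add_one _)] with i h1 h2 h3
    rw [dist_zero_right, Real.norm_eq_abs]
    refine (hM _ _ h1 h2).trans_lt ?_
    rw [div_mul_eq_mul_div, div_lt_iff₀ (by positivity)]
    gcongr
  have h1 := (Real.continuous_exp.tendsto _).comp (hdiff.add (hlog.const_mul ρ))
  rw [zero_add, mul_comm ρ, ← Real.rpow_def_of_pos hx] at h1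
  refine h1.congr fun i => ?_
  simp only [Function.comp, sub_add_cancel]
  rw [Real.exp_sub, Real.exp_log (hu _), Real.exp_log (hu _)]

/-- Potter's bound for an antitone normalised regularly varying sequence. -/
lemma NormalizedRegVar.potter {u : ℕ → ℝ} {δ δ' : ℝ} (h : NormalizedRegVar u (-δ))
    (hu : ∀ n, 0 < u n) (hanti : Antitone u) (hδ : 0 < δ') (hδ' : δ < δ') :
    ∃ C : ℝ, 0 < C ∧ ∃ M : ℕ, ∀ n, M ≤ n → ∀ m, m ≤ n →
      u m ≤ C * u n * ((n + 1) / (m + 1) : ℝ) ^ δ' := by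
  obtain ⟨M, hM1, hM⟩ := h (δ' - δ) (by linarith)
  have key : ∀ m n : ℕ, M ≤ m → m ≤ n → u m ≤ u n * (n / m : ℝ) ^ δ' := by
    intro m n hm hmn
    have hm0 : (0 : ℝ) < m := by exact_mod_cast hM1.trans hm
    have hn0 : (0 : ℝ) < n := hm0.trans_le (by exact_mod_cast hmn)
    have h1 := (abs_le.1 (hM m n hm hmn)).1
    have h2 : Real.log (u m) ≤ Real.log (u n * (n / m : ℝ) ^ δ') := by
      rw [Real.log_mul (hu n).ne' (by positivity), Real.log_rpow (by positivity),
        Real.log_div hn0.ne' hm0.ne']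
      linarith
    exact (Real.log_le_log_iff (hu m) (mul_pos (hu n) (by positivity))).1 h2
  have hr : 1 ≤ u 0 / u M := (one_le_div (hu M)).2 (hanti (Nat.zero_le _))
  -- The factor `2 ^ δ'` pays for replacing `n / m` by `(n + 1) / (m + 1)`, the factor `u 0 / u M` for
  -- the indices below `M`.
  refine ⟨2 ^ δ' * (u 0 / u M), mul_pos (by positivity) (by linarith), M, fun n hn m hmn => ?_⟩
  have hun := hu n
  rcases le_or_gt M m with hm | hm
  · have hm0 : (1 : ℝ) ≤ m := by exact_mod_cast hM1.trans hm
    have h1 : (n / m : ℝ) ≤ 2 * ((n + 1) / (m + 1)) := by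
      rw [← mul_div_assoc, div_le_div_iff₀ (by positivity) (by positivity)]
      nlinarith [Nat.cast_nonneg (α := ℝ) n]
    calc u m ≤ u n * (n / m : ℝ) ^ δ' := key m n hm hmn
      _ ≤ u n * (2 * ((n + 1) / (m + 1)) : ℝ) ^ δ' := by gcongr
      _ = 1 * (2 ^ δ' * u n * ((n + 1) / (m + 1) : ℝ) ^ δ') := by
        rw [Real.mul_rpow (by norm_num) (by positivity)]; ring
      _ ≤ (u 0 / u M) * (2 ^ δ' * u n * ((n + 1) / (m + 1) : ℝ) ^ δ') := by gcongr
      _ = _ := by ring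
  · have hM0 : (0 : ℝ) < M := by exact_mod_cast hM1
    have h1 : (n / M : ℝ) ≤ (n + 1) / (m + 1) := by
      have : (m + 1 : ℝ) ≤ M := by exact_mod_cast hm
      gcongr; linarith
    have h2 : (1 : ℝ) ≤ 2 ^ δ' := Real.one_le_rpow (by norm_num) hδ.le
    have h3 := key M n le_rfl hn
    have huM := hu M
    have hu0 := hu 0
    calc u m ≤ u 0 := hanti (Nat.zero_le _)
      _ = 1 * (u 0 / u M * u M) := by field_simp
      _ ≤ 2 ^ δ' * (u 0 / u M * (u n * ((n + 1) / (m + 1) : ℝ) ^ δ')) := by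
        gcongr
        exact h3.trans (by gcongr)
      _ = _ := by ring

lemma map_floor_volume_Ioi :
    (volume.restrict (Set.Ioi (0 : ℝ))).map (fun x => ⌊x⌋₊) = Measure.count := by
  refine Measure.ext_of_singleton fun n => ?_
  rw [Measure.map_apply Nat.measurable_floor (measurableSet_singleton n),
    Measure.restrict_congr_set Ioi_ae_eq_Ici,
    Measure.restrict_apply (Nat.measurable_floor (measurableSet_singleton n)),
    Measure.count_singleton]
  have : (fun x : ℝ => ⌊x⌋₊) ⁻¹' {n} ∩ Set.Ici 0 = Set.Ico (n : ℝ) (n + 1) := by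
    ext x
    simp only [Set.mem_inter_iff, Set.mem_preimage, Set.mem_singleton_iff, Set.mem_Ici, Set.mem_Ico]
    constructor
    · rintro ⟨h1, h2⟩; exact (Nat.floor_eq_iff h2).1 h1
    · intro h
      have h0 : 0 ≤ x := (Nat.cast_nonneg n).trans h.1
      exact ⟨(Nat.floor_eq_iff h0).2 h, h0⟩
  rw [this, Real.volume_Ico]
  simp

lemma tsum_eq_mul_integral_floor {F : ℕ → ℝ} (hF : Summable F) {n : ℕ} (hn : 0 < n) :
    ∑' m, F m = n * ∫ x in Set.Ioi (0 : ℝ), F ⌊(n : ℝ) * x⌋₊ := by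
  have hn0 : (0 : ℝ) < n := by exact_mod_cast hn
  rw [integral_comp_mul_left_Ioi (fun x => F ⌊x⌋₊) 0 hn0, mul_zero, smul_eq_mul, ← mul_assoc,
    mul_inv_cancel₀ hn0.ne', one_mul,
    ← integral_map (φ := fun x : ℝ => ⌊x⌋₊) (f := F) Nat.measurable_floor.aemeasurable
      (measurable_from_nat.aestronglyMeasurable), map_floor_volume_Ioi]
  rw [integral_countable (by rw [integrable_count_iff]; exact hF.norm)]
  simp [Measure.real]

/-- Karamata's Abelian theorem: the generating function of a regularly varying sequence `u` of
index `-δ ∈ (-1, 0)` behaves like that of `n ^ (-δ)`. -/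
lemma NormalizedRegVar.tendsto_genFun {u : ℕ → ℝ} {δ : ℝ} (h : NormalizedRegVar u (-δ))
    (hu : ∀ n, 0 < u n) (hanti : Antitone u) (hδ : δ ∈ Set.Ioo (0 : ℝ) 1)
    {lam : ℝ} (hlam : 0 < lam) :
    Tendsto (fun n : ℕ => (∑' m, u m * Real.exp (-lam / n) ^ m) / (n * u n)) atTop
      (𝓝 (Real.Gamma (1 - δ) * lam ^ (δ - 1))) := by
  obtain ⟨δ', hδ1, hδ2⟩ := exists_between hδ.2
  obtain ⟨C, hC, M, hM⟩ := h.potter hu hanti (hδ.1.trans hδ1) hδ1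
  have hlimval : ∫ x in Set.Ioi (0 : ℝ), x ^ (-δ) * Real.exp (-(lam * x))
      = Real.Gamma (1 - δ) * lam ^ (δ - 1) := by
    have := Real.integral_rpow_mul_exp_neg_mul_Ioi (a := 1 - δ) (r := lam)
      (by linarith [hδ.2]) hlam
    rw [show 1 - δ - 1 = -δ by ring] at this
    rw [this, one_div, Real.inv_rpow hlam.le, ← Real.rpow_neg hlam.le, neg_sub, mul_comm]
  rw [← hlimval]
  have hmain : Tendsto (fun n : ℕ => ∫ x in Set.Ioi (0 : ℝ),
      u ⌊(n : ℝ) * x⌋₊ / u n * Real.exp (-lam / n) ^ ⌊(n : ℝ) * x⌋₊) atTop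
      (𝓝 (∫ x in Set.Ioi (0 : ℝ), x ^ (-δ) * Real.exp (-(lam * x)))) := by
    -- Potter's bound dominates the integrand for `x ≤ 1`, monotonicity of `u` for `x ≥ 1`.
    refine tendsto_integral_filter_of_dominated_convergence
      (fun x => (C * 2 ^ δ' * x ^ (-δ') + 1) * Real.exp lam * Real.exp (-lam * x)) ?_ ?_ ?_ ?_
    · refine Eventually.of_forall fun n => ?_
      have h1 : Measurable fun x : ℝ => ⌊(n : ℝ) * x⌋₊ :=
        Nat.measurable_floor.comp (measurable_const_mul _)
      exact ((measurable_from_nat (f := fun m => u m / u n * Real.exp (-lam / n) ^ m)).comp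
        h1).aestronglyMeasurable
    · filter_upwards [eventually_ge_atTop M, eventually_ge_atTop 1] with n hnM hn1
      refine (ae_restrict_iff' measurableSet_Ioi).2 (Eventually.of_forall fun x hx => ?_)
      have hx : 0 < x := hx
      have hn0 : (0 : ℝ) < n := by exact_mod_cast hn1
      set m := ⌊(n : ℝ) * x⌋₊ with hmdef
      have hmx : (n : ℝ) * x < m + 1 := Nat.lt_floor_add_one _
      have hun := hu n
      have hum := hu m
      rw [Real.norm_of_nonneg (by positivity)]
      have he : Real.exp (-lam / n) ^ m ≤ Real.exp lam * Real.exp (-lam * x) := by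
        rw [← Real.exp_nat_mul, ← Real.exp_add, Real.exp_le_exp]
        have : (m + 1 : ℝ) / n ≥ x := by rw [ge_iff_le, le_div_iff₀ hn0]; linarith
        have hn1' : (1 : ℝ) / n ≤ 1 := by
          rw [div_le_one hn0]; exact_mod_cast hn1
        have e : (m : ℝ) * (-lam / n) = lam * (1 / n) - lam * ((m + 1) / n) := by
          field_simp; ring
        rw [e]
        nlinarith
      have hratio : u m / u n ≤ C * 2 ^ δ' * x ^ (-δ') + 1 := by
        rcases le_total m n with hmn | hmn
        · have h1 := hM n hnM m hmn
          have h2 : ((n + 1) / (m + 1) : ℝ) ≤ 2 * x⁻¹ := by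
            rw [div_le_iff₀ (by positivity), mul_assoc, ← div_eq_inv_mul, ← mul_div_assoc,
              le_div_iff₀ hx]
            have : (1 : ℝ) ≤ n := by exact_mod_cast hn1
            nlinarith
          have h3 : u m ≤ C * u n * (2 * x⁻¹) ^ δ' :=
            h1.trans (by have := hδ.1.trans hδ1; gcongr)
          rw [Real.mul_rpow (by norm_num) (by positivity), Real.inv_rpow hx.le,
            ← Real.rpow_neg hx.le] at h3
          rw [div_le_iff₀ hun]
          nlinarith
        · have h1 : u m / u n ≤ 1 := (div_le_one hun).2 (hanti hmn)
          have : 0 ≤ C * 2 ^ δ' * x ^ (-δ') := by positivity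
          linarith
      calc u m / u n * Real.exp (-lam / n) ^ m
          ≤ (C * 2 ^ δ' * x ^ (-δ') + 1) * (Real.exp lam * Real.exp (-lam * x)) := by
            gcongr
        _ = _ := by ring
    · have h1 := (integrableOn_rpow_mul_exp_neg_mul_rpow (p := 1) (s := -δ') (b := lam)
        (by linarith) one_pos hlam).const_mul (C * 2 ^ δ' * Real.exp lam)
      have h2 := (integrableOn_rpow_mul_exp_neg_mul_rpow (p := 1) (s := 0) (b := lam)
        (by linarith) one_pos hlam).const_mul (Real.exp lam)
      refine (h1.add h2).congr (Eventually.of_forall fun x => ?_)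
      simp only [Pi.add_apply, Real.rpow_one, Real.rpow_zero]
      ring
    · refine (ae_restrict_iff' measurableSet_Ioi).2 (Eventually.of_forall fun x hx => ?_)
      have hx : 0 < x := hx
      have h1 : Tendsto (fun n : ℕ => (⌊(n : ℝ) * x⌋₊ : ℝ) / n) atTop (𝓝 x) := by
        simpa [mul_comm, Function.comp_def] using
          (tendsto_nat_floor_mul_div_atTop hx.le).comp (tendsto_natCast_atTop_atTop (R := ℝ))
      have h2 : Tendsto (fun n : ℕ => ⌊(n : ℝ) * x⌋₊) atTop atTop :=
        tendsto_nat_floor_atTop.comp ((tendsto_natCast_atTop_atTop (R := ℝ)).atTop_mul_const hx)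
      refine (h.tendsto_div hu h2 tendsto_id hx h1).mul ?_
      have h3 := (Real.continuous_exp.tendsto _).comp (h1.const_mul lam).neg
      refine h3.congr fun n => ?_
      simp only [Function.comp]
      rw [← Real.exp_nat_mul]
      congr 1; ring
  refine hmain.congr' ?_
  filter_upwards [eventually_ge_atTop 1] with n hn
  have hn0 : (0 : ℝ) < n := by exact_mod_cast hn
  have hs : Summable fun m => u m / u n * Real.exp (-lam / n) ^ m := by
    refine Summable.of_nonneg_of_le (fun m => by have := hu m; have := hu n; positivity)
      (fun m => mul_le_mul_of_nonneg_right (div_le_div_of_nonneg_right (hanti (Nat.zero_le m))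
        (hu n).le) (by positivity))
      ((summable_geometric_of_lt_one (Real.exp_pos _).le ?_).mul_left (u 0 / u n))
    rw [Real.exp_lt_one_iff]
    exact div_neg_of_neg_of_pos (by linarith) hn0
  have h1 := tsum_eq_mul_integral_floor hs hn
  have h2 : ∑' m, u m / u n * Real.exp (-lam / n) ^ m
      = (∑' m, u m * Real.exp (-lam / n) ^ m) / u n := by
    rw [← tsum_div_const]; exact tsum_congr fun m => by ring
  rw [eq_comm, ← div_div, div_right_comm, ← h2, h1, mul_div_cancel_left₀ _ hn0.ne']

/-! ### A Tauberian theorem for monotone sequences -/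

/-- The method of moments on `[0, 1]`, where polynomials are uniformly dense. -/
lemma tendsto_of_tendsto_moments {ρ : ℕ → ProbabilityMeasure ℝ} {ρ' : ProbabilityMeasure ℝ}
    (hρ : ∀ n, ∀ᵐ y ∂(ρ n : Measure ℝ), y ∈ Set.Icc (0 : ℝ) 1)
    (hρ' : ∀ᵐ y ∂(ρ' : Measure ℝ), y ∈ Set.Icc (0 : ℝ) 1)
    (hmom : ∀ i : ℕ, Tendsto (fun n => ∫ y, y ^ i ∂(ρ n : Measure ℝ)) atTop
      (𝓝 (∫ y, y ^ i ∂(ρ' : Measure ℝ)))) :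
    Tendsto ρ atTop (𝓝 ρ') := by
  have hint : ∀ (σ : ProbabilityMeasure ℝ), (∀ᵐ y ∂(σ : Measure ℝ), y ∈ Set.Icc (0 : ℝ) 1) →
      ∀ i : ℕ, Integrable (fun y : ℝ => y ^ i) (σ : Measure ℝ) := fun σ hσ i =>
    Integrable.of_bound (by fun_prop) 1 (by
      filter_upwards [hσ] with y hy
      rw [Real.norm_of_nonneg (pow_nonneg hy.1 i)]
      exact pow_le_one₀ hy.1 hy.2)
  have hpoly : ∀ (σ : ProbabilityMeasure ℝ), (∀ᵐ y ∂(σ : Measure ℝ), y ∈ Set.Icc (0 : ℝ) 1) →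
      ∀ p : Polynomial ℝ, Integrable (fun y : ℝ => p.eval y) (σ : Measure ℝ) ∧
        ∫ y, p.eval y ∂(σ : Measure ℝ)
        = ∑ i ∈ Finset.range (p.natDegree + 1), p.coeff i * ∫ y, y ^ i ∂(σ : Measure ℝ) := by
    intro σ hσ p
    simp only [Polynomial.eval_eq_sum_range]
    refine ⟨integrable_finsetSum _ fun i _ => (hint σ hσ i).const_mul _, ?_⟩
    rw [integral_finsetSum _ fun i _ => (hint σ hσ i).const_mul _]
    simp only [integral_const_mul]
  rw [ProbabilityMeasure.tendsto_iff_forall_integral_tendsto]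
  intro f
  rw [Metric.tendsto_nhds]
  intro ε hε
  obtain ⟨p, hp⟩ := exists_polynomial_near_of_continuousOn 0 1 f f.continuous.continuousOn
    (ε / 3) (by positivity)
  have hclose : ∀ (σ : ProbabilityMeasure ℝ), (∀ᵐ y ∂(σ : Measure ℝ), y ∈ Set.Icc (0 : ℝ) 1) →
      |∫ y, f y ∂(σ : Measure ℝ) - ∫ y, p.eval y ∂(σ : Measure ℝ)| ≤ ε / 3 := by
    intro σ hσ
    rw [← integral_sub (f.integrable _) (hpoly σ hσ p).1, ← Real.norm_eq_abs]
    refine (norm_integral_le_of_norm_le_const (C := ε / 3) ?_).trans (by simp)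
    filter_upwards [hσ] with y hy
    rw [Real.norm_eq_abs, abs_sub_comm]
    exact (hp y hy).le
  have hlim : Tendsto (fun n => ∫ y, p.eval y ∂(ρ n : Measure ℝ)) atTop
      (𝓝 (∫ y, p.eval y ∂(ρ' : Measure ℝ))) := by
    simp only [(hpoly _ (hρ _) p).2, (hpoly _ hρ' p).2]
    exact tendsto_finsetSum _ fun i _ => (hmom i).const_mul _
  filter_upwards [(Metric.tendsto_nhds.1 hlim) (ε / 3) (by positivity)] with n hn
  have h1 := abs_le.1 (hclose (ρ n) (hρ n))
  have h2 := abs_le.1 (hclose ρ' hρ')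
  rw [Real.dist_eq, abs_lt] at hn ⊢
  constructor <;> linarith [h1.1, h1.2, h2.1, h2.2, hn.1, hn.2]

lemma exists_pmf_of_summable {w : ℕ → ℝ} (hw : ∀ k, 0 ≤ w k) (hs : Summable w)
    (hpos : 0 < ∑' k, w k) : ∃ p : PMF ℕ, ∀ k, (p k).toReal = w k / ∑' k, w k := by
  have h0 : ∀ k, 0 ≤ w k / ∑' k, w k := fun k => div_nonneg (hw k) hpos.le
  refine ⟨⟨fun k => ENNReal.ofReal (w k / ∑' k, w k), ?_⟩, fun k => ENNReal.toReal_ofReal (h0 k)⟩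
  rw [ENNReal.summable.hasSum_iff, ← ENNReal.ofReal_tsum_of_nonneg h0 (hs.div_const _),
    tsum_div_const, div_self hpos.ne', ENNReal.ofReal_one]

lemma integral_exp_neg_pow_gammaMeasure {δ : ℝ} (hδ : 0 < δ) (i : ℕ) :
    ∫ y, Real.exp (-y) ^ i ∂(gammaMeasure δ 1) = ((i : ℝ) + 1) ^ (-δ) := by
  rw [gammaMeasure, integral_withDensity_eq_integral_toReal_smul
    (by exact (measurable_gammaPDFReal δ 1).ennreal_ofReal)
    (Eventually.of_forall fun y => by simp [gammaPDF])]
  have h1 : ∀ y, (gammaPDF δ 1 y).toReal • Real.exp (-y) ^ i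
      = (Set.Ici (0 : ℝ)).indicator
        (fun y => (Real.Gamma δ)⁻¹ * (y ^ (δ - 1) * Real.exp (-((i + 1) * y)))) y := by
    intro y
    rw [gammaPDF, ENNReal.toReal_ofReal (gammaPDFReal_nonneg hδ one_pos y), gammaPDFReal]
    by_cases hy : 0 ≤ y
    · rw [Set.indicator_of_mem (by exact hy), if_pos hy, ← Real.exp_nat_mul]
      rw [show -((i + 1) * y) = -(1 * y) + i * -y by ring, Real.exp_add, Real.one_rpow, smul_eq_mul]
      ring
    · rw [Set.indicator_of_notMem (by exact hy), if_neg hy, zero_smul]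
  simp_rw [h1]
  rw [integral_indicator measurableSet_Ici, integral_Ici_eq_integral_Ioi, integral_const_mul,
    Real.integral_rpow_mul_exp_neg_mul_Ioi hδ (by positivity), one_div,
    Real.inv_rpow (by positivity), Real.rpow_neg (by positivity)]
  have := (Real.Gamma_pos_of_pos hδ).ne'
  field_simp

lemma gammaPDFReal_le_of_le {δ : ℝ} (hδ : δ ∈ Set.Ioo (0 : ℝ) 1) {a b : ℝ} (ha : 0 < a)
    (hab : a ≤ b) : gammaPDFReal δ 1 b ≤ gammaPDFReal δ 1 a := by
  have hb := ha.trans_le hab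
  rw [gammaPDFReal, gammaPDFReal, if_pos ha.le, if_pos hb.le, Real.one_rpow]
  have := Real.Gamma_pos_of_pos hδ.1
  have h1 : b ^ (δ - 1) ≤ a ^ (δ - 1) :=
    Real.rpow_le_rpow_of_nonpos ha hab (by linarith [hδ.2])
  gcongr

/-- The gamma density with shape parameter below `1` is decreasing, so it bounds the mass of an
interval by its values at the end points. -/
lemma gammaMeasure_real_Ico_mem {δ : ℝ} (hδ : δ ∈ Set.Ioo (0 : ℝ) 1) {a b : ℝ} (ha : 0 < a)
    (hab : a ≤ b) : (gammaMeasure δ 1).real (Set.Ico a b)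
      ∈ Set.Icc (gammaPDFReal δ 1 b * (b - a)) (gammaPDFReal δ 1 a * (b - a)) := by
  have := isProbabilityMeasure_gammaMeasure hδ.1 one_pos
  have hnn := gammaPDFReal_nonneg hδ.1 one_pos
  have hba : 0 ≤ b - a := sub_nonneg.2 hab
  have hm : gammaMeasure δ 1 (Set.Ico a b) = ∫⁻ y in Set.Ico a b, gammaPDF δ 1 y := by
    rw [gammaMeasure, withDensity_apply _ measurableSet_Ico]
  have hle : ENNReal.ofReal (gammaPDFReal δ 1 b * (b - a)) ≤ gammaMeasure δ 1 (Set.Ico a b) := by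
    rw [hm, ENNReal.ofReal_mul (hnn b), ← Real.volume_Ico, ← setLIntegral_const]
    exact setLIntegral_mono' measurableSet_Ico fun y hy =>
      ENNReal.ofReal_le_ofReal (gammaPDFReal_le_of_le hδ (ha.trans_le hy.1) hy.2.le)
  have hge : gammaMeasure δ 1 (Set.Ico a b) ≤ ENNReal.ofReal (gammaPDFReal δ 1 a * (b - a)) := by
    rw [hm, ENNReal.ofReal_mul (hnn a), ← Real.volume_Ico, ← setLIntegral_const]
    exact setLIntegral_mono' measurableSet_Ico fun y hy =>
      ENNReal.ofReal_le_ofReal (gammaPDFReal_le_of_le hδ ha hy.1)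
  exact ⟨(ENNReal.ofReal_le_iff_le_toReal (measure_ne_top _ _)).1 hle,
    ENNReal.toReal_le_of_le_ofReal (mul_nonneg (hnn a) hba) hge⟩

/-- Karamata's Tauberian theorem with a monotone density: if the generating function
`V(r) = ∑ v k * r ^ k` is regularly varying of index `-δ` at `1`, then the antitone sequence `v`
satisfies `v k ∼ k ^ (δ - 1) * V(exp (-h)) * h ^ δ / Γ(δ)` at `k ≈ x / h`. -/
lemma tendsto_of_tendsto_genFun_ratio {v : ℕ → ℝ} {δ : ℝ} (hδ : δ ∈ Set.Ioo (0 : ℝ) 1)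
    (hv : ∀ k, 0 ≤ v k) (hv0 : 0 < v 0) (hanti : Antitone v) {h : ℕ → ℝ} (hh : ∀ n, 0 < h n)
    (hh0 : Tendsto h atTop (𝓝 0))
    (hV : ∀ i : ℕ, Tendsto (fun n => (∑' k, v k * Real.exp (-(i + 1) * h n) ^ k) /
      ∑' k, v k * Real.exp (-h n) ^ k) atTop (𝓝 (((i : ℝ) + 1) ^ (-δ))))
    {K : ℕ → ℕ} {x : ℝ} (hx : 0 < x) (hK : Tendsto (fun n => (K n : ℝ) * h n) atTop (𝓝 x)) :
    Tendsto (fun n => v (K n) / (h n * ∑' k, v k * Real.exp (-h n) ^ k)) atTop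
      (𝓝 (x ^ (δ - 1) / Real.Gamma δ)) := by
  have := isProbabilityMeasure_gammaMeasure hδ.1 one_pos
  set w : ℕ → ℕ → ℝ := fun n k => v k * Real.exp (-h n) ^ k with hwdef
  have hw0 : ∀ n k, 0 ≤ w n k := fun n k => mul_nonneg (hv k) (by positivity)
  have hr1 : ∀ n, Real.exp (-h n) < 1 := fun n => by
    rw [Real.exp_lt_one_iff]; linarith [hh n]
  have hws : ∀ n, Summable (w n) := fun n =>
    Summable.of_nonneg_of_le (hw0 n) (fun k => mul_le_mul_of_nonneg_right (hanti (Nat.zero_le k))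
      (by positivity)) ((summable_geometric_of_lt_one (Real.exp_pos _).le (hr1 n)).mul_left (v 0))
  have hwanti : ∀ n, Antitone (w n) := fun n i j hij =>
    mul_le_mul (hanti hij) (pow_le_pow_of_le_one (Real.exp_pos _).le (hr1 n).le hij)
      (by positivity) (hv _)
  set V : ℕ → ℝ := fun n => ∑' k, w n k with hVdef
  have hVpos : ∀ n, 0 < V n := fun n => (hws n).tsum_pos (hw0 n) 0 (by simpa [hwdef] using hv0)
  choose p hp using fun n => exists_pmf_of_summable (hw0 n) (hws n) (hVpos n)
  have hme : ∀ n, Measurable fun k : ℕ => Real.exp (-h n) ^ k := fun n => measurable_from_nat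
  let ρ : ℕ → ProbabilityMeasure ℝ := fun n =>
    ⟨(p n).toMeasure.map (fun k => Real.exp (-h n) ^ k),
      Measure.isProbabilityMeasure_map (hme n).aemeasurable⟩
  let ρ' : ProbabilityMeasure ℝ := ⟨(gammaMeasure δ 1).map (fun y => Real.exp (-y)),
      Measure.isProbabilityMeasure_map (by fun_prop)⟩
  have hnonneg : ∀ᵐ y ∂(gammaMeasure δ 1), 0 ≤ y := by
    rw [ae_iff, gammaMeasure, withDensity_apply _ (by simp only [not_le]; exact measurableSet_Iio)]
    simp only [not_le]
    exact (setLIntegral_congr_fun measurableSet_Iio fun y hy => gammaPDF_of_neg hy).trans (by simp)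
  have hatom : ∀ c, (ρ' : Measure ℝ) {c} = 0 := by
    intro c
    have : (ρ' : Measure ℝ) {c} = gammaMeasure δ 1 ((fun y => Real.exp (-y)) ⁻¹' {c}) :=
      Measure.map_apply (by fun_prop) (measurableSet_singleton c)
    rw [this]
    refine withDensity_absolutelyContinuous _ _ (Set.Subsingleton.measure_zero ?_ _)
    intro y hy z hz
    exact neg_injective (Real.exp_injective (Eq.trans hy (Eq.symm hz)))
  have hconv : Tendsto ρ atTop (𝓝 ρ') := by
    refine tendsto_of_tendsto_moments (fun n => ?_) ?_ fun i => ?_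
    · refine (ae_map_iff (hme n).aemeasurable measurableSet_Icc).2 (Eventually.of_forall fun k => ?_)
      exact ⟨by positivity, pow_le_one₀ (Real.exp_pos _).le (hr1 n).le⟩
    · refine (ae_map_iff (by fun_prop) measurableSet_Icc).2 ?_
      filter_upwards [hnonneg] with y hy
      exact ⟨by positivity, by rw [Real.exp_le_one_iff]; linarith⟩
    · have e1 : ∫ y, y ^ i ∂(ρ' : Measure ℝ) = ((i : ℝ) + 1) ^ (-δ) := by
        rw [← integral_exp_neg_pow_gammaMeasure hδ.1 i]
        exact integral_map (by fun_prop) (by fun_prop)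
      have e2 : ∀ n, ∫ y, y ^ i ∂(ρ n : Measure ℝ)
          = (∑' k, v k * Real.exp (-(i + 1) * h n) ^ k) / V n := by
        intro n
        have : ∫ y, y ^ i ∂(ρ n : Measure ℝ) = ∫ k, (Real.exp (-h n) ^ k) ^ i ∂(p n).toMeasure :=
          integral_map (hme n).aemeasurable (by fun_prop)
        rw [this, PMF.integral_eq_tsum _ _ (Integrable.of_bound
          (measurable_from_nat.aestronglyMeasurable) 1 (Eventually.of_forall fun k => by
            rw [Real.norm_of_nonneg (by positivity)]
            exact pow_le_one₀ (by positivity) (pow_le_one₀ (Real.exp_pos _).le (hr1 n).le))),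
          ← tsum_div_const]
        refine tsum_congr fun k => ?_
        simp only [hp, smul_eq_mul, hVdef, hwdef, ← Real.exp_nat_mul]
        rw [show (k : ℝ) * (-(i + 1) * h n) = k * -h n + i * (k * -h n) by ring, Real.exp_add]
        ring
      rw [e1]
      simp_rw [e2]
      exact hV i
  have hIco : ∀ a b : ℝ, a < b → Tendsto (fun n =>
      (∑ k ∈ Finset.Ico ⌈a / h n⌉₊ ⌈b / h n⌉₊, w n k) / V n) atTop
      (𝓝 ((gammaMeasure δ 1).real (Set.Ico a b))) := by
    intro a b hab
    have hpre : ∀ y, Real.exp (-y) ∈ Set.Ioc (Real.exp (-b)) (Real.exp (-a)) ↔ a ≤ y ∧ y < b :=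
      fun y => by rw [Set.mem_Ioc, Real.exp_lt_exp, Real.exp_le_exp, neg_lt_neg_iff,
        neg_le_neg_iff, and_comm]
    have h1 := ProbabilityMeasure.tendsto_measure_of_null_frontier_of_tendsto' hconv
      (E := Set.Ioc (Real.exp (-b)) (Real.exp (-a))) (by
        rw [frontier_Ioc (Real.exp_lt_exp.2 (neg_lt_neg hab)), Set.insert_eq]
        exact measure_union_null (hatom _) (hatom _))
    have e1 : (ρ' : Measure ℝ) (Set.Ioc (Real.exp (-b)) (Real.exp (-a)))
        = gammaMeasure δ 1 (Set.Ico a b) := by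
      refine (Measure.map_apply (by fun_prop) measurableSet_Ioc).trans ?_
      congr 1; ext y; exact hpre y
    rw [e1] at h1
    refine ((ENNReal.tendsto_toReal (measure_ne_top _ _)).comp h1).congr fun n => ?_
    have e2 : (ρ n : Measure ℝ) (Set.Ioc (Real.exp (-b)) (Real.exp (-a)))
        = (p n).toMeasure (Finset.Ico ⌈a / h n⌉₊ ⌈b / h n⌉₊ : Finset ℕ) := by
      refine (Measure.map_apply (hme n) measurableSet_Ioc).trans ?_
      congr 1; ext k
      rw [Set.mem_preimage, ← Real.exp_nat_mul, mul_neg, hpre, Finset.coe_Ico, Set.mem_Ico,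
        Nat.ceil_le, Nat.lt_ceil, div_le_iff₀ (hh n), lt_div_iff₀ (hh n)]
    rw [Function.comp, e2, PMF.toMeasure_apply_finset,
      ENNReal.toReal_sum fun k _ => (p n).apply_ne_top k, Finset.sum_div]
    exact Finset.sum_congr rfl fun k _ => hp n k
  have hcount : ∀ a b : ℝ, 0 < a → a ≤ b → Tendsto (fun n =>
      h n * (Finset.Ico ⌈a / h n⌉₊ ⌈b / h n⌉₊).card) atTop (𝓝 (b - a)) := by
    intro a b ha hab
    have hceil : ∀ y : ℝ, 0 < y → Tendsto (fun n => h n * (⌈y / h n⌉₊ : ℝ)) atTop (𝓝 y) := by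
      intro y hy
      refine tendsto_of_tendsto_of_tendsto_of_le_of_le tendsto_const_nhds
        (by simpa using hh0.const_add y) (fun n => ?_) (fun n => ?_)
      · have := Nat.le_ceil (y / h n)
        rwa [div_le_iff₀ (hh n), mul_comm] at this
      · have h1 := (Nat.ceil_lt_add_one (div_pos hy (hh n)).le).le
        have h2 := mul_le_mul_of_nonneg_left h1 (hh n).le
        rwa [mul_add, mul_div_cancel₀ _ (hh n).ne', mul_one] at h2
    refine ((hceil b (ha.trans_le hab)).sub (hceil a ha)).congr fun n => ?_
    rw [Nat.card_Ico, Nat.cast_sub (Nat.ceil_mono (div_le_div_of_nonneg_right hab (hh n).le))]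
    ring
  have hcont : ContinuousAt (gammaPDFReal δ 1) x := by
    have h1 : ContinuousAt (fun y => 1 ^ δ / Real.Gamma δ * y ^ (δ - 1) * Real.exp (-(1 * y))) x :=
      (continuousAt_const.mul (Real.continuousAt_rpow_const x _ (Or.inl hx.ne'))).mul
        (by fun_prop)
    refine h1.congr ?_
    filter_upwards [lt_mem_nhds hx] with y hy
    rw [gammaPDFReal, if_pos hy.le]
  -- The weights decrease, so `w n (K n)` is at least their average over `k * h n ∈ [a, b)` if
  -- `x < a`, and at most that average if `b < x`.
  have hγ : Tendsto (fun n => w n (K n) / (h n * V n)) atTop (𝓝 (gammaPDFReal δ 1 x)) := by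
    refine tendsto_order.2 ⟨fun B hB => ?_, fun B hB => ?_⟩
    · obtain ⟨b, hb1, hb2⟩ := (((hcont.eventually_const_lt hB).filter_mono
        nhdsWithin_le_nhds).and (self_mem_nhdsWithin : Set.Ioi x ∈ 𝓝[>] x)).exists
      obtain ⟨a, ha1, ha2⟩ := exists_between (show x < b from hb2)
      have ha0 := hx.trans ha1
      have hlt : B * (b - a) < (gammaMeasure δ 1).real (Set.Ico a b) :=
        (mul_lt_mul_of_pos_right hb1 (sub_pos.2 ha2)).trans_le
          (gammaMeasure_real_Ico_mem hδ ha0 ha2.le).1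
      filter_upwards [((hcount a b ha0 ha2.le).const_mul B).eventually_lt (hIco a b ha2) hlt,
        hK.eventually_lt_const ha1, (hcount a b ha0 ha2.le).eventually_const_lt (sub_pos.2 ha2)]
        with n h1 h2 h3
      have hhn := hh n
      have hVn := hVpos n
      have h4 : ∑ k ∈ Finset.Ico ⌈a / h n⌉₊ ⌈b / h n⌉₊, w n k
          ≤ (Finset.Ico ⌈a / h n⌉₊ ⌈b / h n⌉₊).card • w n (K n) := by
        refine Finset.sum_le_card_nsmul _ _ _ fun k hk => hwanti n ?_
        refine le_trans ?_ (Finset.mem_Ico.1 hk).1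
        have : (K n : ℝ) ≤ a / h n := by rw [le_div_iff₀ hhn]; exact h2.le
        exact_mod_cast this.trans (Nat.le_ceil _)
      rw [nsmul_eq_mul] at h4
      have h5 := h1.trans_le (div_le_div_of_nonneg_right h4 hVn.le)
      have h6 : ((Finset.Ico ⌈a / h n⌉₊ ⌈b / h n⌉₊).card : ℝ) * w n (K n) / V n
        = w n (K n) / (h n * V n) * (h n * (Finset.Ico ⌈a / h n⌉₊ ⌈b / h n⌉₊).card) := by
        field_simp
      rw [h6] at h5
      exact lt_of_mul_lt_mul_right h5 h3.le
    · obtain ⟨a, ha1, ha2⟩ := (((hcont.eventually_lt_const hB).filter_mono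
        nhdsWithin_le_nhds).and (Ioo_mem_nhdsLT hx)).exists
      obtain ⟨b, hb1, hb2⟩ := exists_between ha2.2
      have ha0 := ha2.1
      have hlt : (gammaMeasure δ 1).real (Set.Ico a b) < B * (b - a) :=
        (gammaMeasure_real_Ico_mem hδ ha0 hb1.le).2.trans_lt
          (mul_lt_mul_of_pos_right ha1 (sub_pos.2 hb1))
      filter_upwards [(hIco a b hb1).eventually_lt ((hcount a b ha0 hb1.le).const_mul B) hlt,
        hK.eventually_const_lt hb2, (hcount a b ha0 hb1.le).eventually_const_lt (sub_pos.2 hb1)]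
        with n h1 h2 h3
      have hhn := hh n
      have hVn := hVpos n
      have h4 : (Finset.Ico ⌈a / h n⌉₊ ⌈b / h n⌉₊).card • w n (K n)
          ≤ ∑ k ∈ Finset.Ico ⌈a / h n⌉₊ ⌈b / h n⌉₊, w n k := by
        refine Finset.card_nsmul_le_sum _ _ _ fun k hk => hwanti n ?_
        refine (Finset.mem_Ico.1 hk).2.le.trans (Nat.ceil_le.2 ?_)
        rw [div_le_iff₀ hhn]; exact h2.le
      rw [nsmul_eq_mul] at h4
      have h5 := (div_le_div_of_nonneg_right h4 hVn.le).trans_lt h1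
      have h6 : ((Finset.Ico ⌈a / h n⌉₊ ⌈b / h n⌉₊).card : ℝ) * w n (K n) / V n
        = w n (K n) / (h n * V n) * (h n * (Finset.Ico ⌈a / h n⌉₊ ⌈b / h n⌉₊).card) := by
        field_simp
      rw [h6] at h5
      exact lt_of_mul_lt_mul_right h5 h3.le
  have h1 := hγ.mul ((Real.continuous_exp.tendsto x).comp hK)
  rw [gammaPDFReal, if_pos hx.le, Real.one_rpow, mul_assoc (1 / Real.Gamma δ * _), ← Real.exp_add,
    one_mul, neg_add_cancel, Real.exp_zero, mul_one, one_div_mul_eq_div] at h1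
  refine h1.congr fun n => ?_
  simp only [hVdef, hwdef, Function.comp, ← Real.exp_nat_mul]
  rw [div_mul_eq_mul_div, mul_assoc, ← Real.exp_add, show (K n : ℝ) * -h n + K n * h n = 0 by ring,
    Real.exp_zero, mul_one]

/-! ### Asymptotics of a renewal pair -/

lemma tsum_mul_tsum_of_renewal {u v : ℕ → ℝ} (hu : ∀ n, 0 ≤ u n) (hua : Antitone u)
    (hv : ∀ n, 0 ≤ v n) (hva : Antitone v)
    (hren : ∀ N, ∑ m ∈ Finset.range (N + 1), u m * v (N - m) = 1) {r : ℝ}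
    (hr : r ∈ Set.Ioo (0 : ℝ) 1) :
    (∑' n, u n * r ^ n) * ∑' n, v n * r ^ n = (1 - r)⁻¹ := by
  have hs : ∀ a : ℕ → ℝ, (∀ n, 0 ≤ a n) → Antitone a → Summable fun n => ‖a n * r ^ n‖ := by
    intro a ha haa
    refine ((summable_geometric_of_lt_one hr.1.le hr.2).mul_left (a 0)).of_nonneg_of_le
      (fun n => norm_nonneg _) fun n => ?_
    rw [Real.norm_of_nonneg (mul_nonneg (ha n) (pow_nonneg hr.1.le n))]
    exact mul_le_mul_of_nonneg_right (haa (Nat.zero_le n)) (pow_nonneg hr.1.le n)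
  rw [tsum_mul_tsum_eq_tsum_sum_range_of_summable_norm (hs u hu hua) (hs v hv hva),
    ← tsum_geometric_of_lt_one hr.1.le hr.2]
  refine tsum_congr fun N => ?_
  rw [← one_mul (r ^ N), ← hren N, Finset.sum_mul]
  refine Finset.sum_congr rfl fun m hm => ?_
  rw [← Nat.add_sub_cancel' (Nat.lt_succ_iff.1 (Finset.mem_range.1 hm)), pow_add,
    Nat.add_sub_cancel_left]
  ring

lemma tendsto_mul_one_sub_exp (lam : ℝ) :
    Tendsto (fun n : ℕ => (n : ℝ) * (1 - Real.exp (-lam / n))) atTop (𝓝 lam) := by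
  have h1 : HasDerivAt (fun x : ℝ => Real.exp (-lam * x)) (-lam) 0 := by
    simpa using ((hasDerivAt_id (0 : ℝ)).const_mul (-lam)).exp
  have h2 := h1.tendsto_slope_zero.comp (tendsto_nhdsWithin_iff.2
    ⟨tendsto_inv_atTop_nhds_zero_nat (𝕜 := ℝ), (eventually_ge_atTop 1).mono fun n hn => by
      simpa using (Nat.one_le_iff_ne_zero.1 hn)⟩)
  have h3 := h2.neg
  rw [neg_neg] at h3
  refine h3.congr fun n => ?_
  simp only [Function.comp, inv_inv, zero_add, mul_zero, Real.exp_zero, smul_eq_mul, div_eq_mul_inv]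
  ring

/-- If `u` and `v` satisfy the renewal equation `∑ u m * v (N - m) = 1` and `u` is regularly varying
of index `-δ`, then `u m * v K` follows the generalised arcsine density. -/
lemma tendsto_mul_of_renewal {u v : ℕ → ℝ} {δ : ℝ} (hδ : δ ∈ Set.Ioo (0 : ℝ) 1)
    (hreg : NormalizedRegVar u (-δ)) (hu : ∀ n, 0 < u n) (hua : Antitone u)
    (hv : ∀ n, 0 ≤ v n) (hva : Antitone v)
    (hren : ∀ N, ∑ m ∈ Finset.range (N + 1), u m * v (N - m) = 1)
    {m K : ℕ → ℕ} {x y : ℝ} (hx : 0 < x) (hy : 0 < y)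
    (hm : Tendsto (fun n => (m n : ℝ) / n) atTop (𝓝 x))
    (hK : Tendsto (fun n => (K n : ℝ) / n) atTop (𝓝 y)) :
    Tendsto (fun n : ℕ => (n : ℝ) * (u (m n) * v (K n))) atTop
      (𝓝 (1 / (Real.Gamma δ * Real.Gamma (1 - δ) * x ^ δ * y ^ (1 - δ)))) := by
  have hG := Real.Gamma_pos_of_pos hδ.1
  have hG' := Real.Gamma_pos_of_pos (show 0 < 1 - δ by linarith [hδ.2])
  have hv0 : 0 < v 0 := by
    have := hren 0
    simp only [zero_add, Finset.sum_range_one] at this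
    by_contra! h
    nlinarith [hu 0, hv 0]
  have hUV : ∀ lam : ℝ, 0 < lam → ∀ n : ℕ, 1 ≤ n →
      (∑' k, u k * Real.exp (-lam / n) ^ k) * ∑' k, v k * Real.exp (-lam / n) ^ k
        = (1 - Real.exp (-lam / n))⁻¹ := fun lam hlam n hn =>
    tsum_mul_tsum_of_renewal (fun n => (hu n).le) hua hv hva hren
      ⟨Real.exp_pos _, Real.exp_lt_one_iff.2 (div_neg_of_neg_of_pos (by linarith)
        (by exact_mod_cast hn))⟩
  have hV : ∀ lam : ℝ, 0 < lam → Tendsto (fun n : ℕ => u n * ∑' k, v k * Real.exp (-lam / n) ^ k)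
      atTop (𝓝 ((Real.Gamma (1 - δ))⁻¹ * lam ^ (-δ))) := by
    intro lam hlam
    have h1 := ((tendsto_mul_one_sub_exp lam).mul (hreg.tendsto_genFun hu hua hδ hlam)).inv₀
      (by positivity)
    have e : (lam * (Real.Gamma (1 - δ) * lam ^ (δ - 1)))⁻¹
        = (Real.Gamma (1 - δ))⁻¹ * lam ^ (-δ) := by
      rw [Real.rpow_sub_one hlam.ne', Real.rpow_neg hlam.le]
      field_simp
    rw [e] at h1
    refine h1.congr' ?_
    filter_upwards [eventually_ge_atTop 1] with n hn
    have hUVn := hUV lam hlam n hn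
    have hn0 : (0 : ℝ) < n := by exact_mod_cast hn
    have hr : Real.exp (-lam / n) < 1 :=
      Real.exp_lt_one_iff.2 (div_neg_of_neg_of_pos (by linarith) hn0)
    have h2 : 1 - Real.exp (-lam / n) ≠ 0 := by linarith
    have hun := (hu n).ne'
    set U := ∑' k, u k * Real.exp (-lam / n) ^ k
    have hU : U ≠ 0 := by
      intro h; rw [h, zero_mul] at hUVn; exact inv_ne_zero h2 hUVn.symm
    have hUV' : ∑' k, v k * Real.exp (-lam / n) ^ k = (1 - Real.exp (-lam / n))⁻¹ / U := by
      rw [eq_div_iff hU, mul_comm]; exact hUVn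
    rw [hUV']
    field_simp
  have hV1 := hV 1 one_pos
  rw [Real.one_rpow, mul_one] at hV1
  have hshift : ∀ n : ℕ, ((n + 1 : ℕ) : ℝ) = n + 1 := fun n => by push_cast; ring
  have hT := tendsto_of_tendsto_genFun_ratio hδ hv hv0 hva (h := fun n : ℕ => 1 / ((n : ℝ) + 1))
    (fun n => by positivity) tendsto_one_div_add_atTop_nhds_zero_nat (fun i => by
      have h1 := ((hV (i + 1) (by positivity)).div hV1 (by positivity)).comp
        (tendsto_add_atTop_nat 1)
      rw [mul_div_cancel_left₀ _ (by positivity)] at h1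
      refine h1.congr fun n => ?_
      simp only [Function.comp, Pi.div_apply, hshift]
      rw [mul_div_mul_left _ _ (hu _).ne']
      simp only [div_eq_mul_inv, one_mul, neg_mul])
    (K := fun n => K (n + 1)) hy (by
      refine ((tendsto_add_atTop_iff_nat 1).2 hK).congr fun n => ?_
      rw [hshift, div_eq_mul_one_div])
  have hT' : Tendsto (fun n : ℕ => (n : ℝ) * v (K n) / ∑' k, v k * Real.exp (-1 / n) ^ k) atTop
      (𝓝 (y ^ (δ - 1) / Real.Gamma δ)) := by
    rw [← tendsto_add_atTop_iff_nat 1]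
    refine hT.congr fun n => ?_
    have : (n : ℝ) + 1 ≠ 0 := by positivity
    rw [hshift, show -1 / ((n : ℝ) + 1) = -(1 / (n + 1)) by ring, ← div_div, div_div_eq_mul_div]
    simp only [div_one, mul_comm]
  have hmt : Tendsto m atTop atTop := by
    have h1 := hm.pos_mul_atTop hx (tendsto_natCast_atTop_atTop (R := ℝ))
    refine tendsto_natCast_atTop_iff.1 (h1.congr' ?_)
    filter_upwards [eventually_ge_atTop 1] with n hn
    have hn0 : (n : ℝ) ≠ 0 := by positivity
    field_simp
  have hprod := (hT'.mul hV1).mul (hreg.tendsto_div hu hmt tendsto_id hx hm)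
  have e : y ^ (δ - 1) / Real.Gamma δ * (Real.Gamma (1 - δ))⁻¹ * x ^ (-δ)
      = 1 / (Real.Gamma δ * Real.Gamma (1 - δ) * x ^ δ * y ^ (1 - δ)) := by
    rw [Real.rpow_neg hx.le, show δ - 1 = -(1 - δ) by ring, Real.rpow_neg hy.le]
    field_simp
  rw [e] at hprod
  refine hprod.congr' ?_
  filter_upwards [eventually_ge_atTop 1] with n hn
  have h1 := hUV 1 one_pos n hn
  have hn0 : (0 : ℝ) < n := by exact_mod_cast hn
  have hr : Real.exp (-1 / n) < 1 :=
    Real.exp_lt_one_iff.2 (div_neg_of_neg_of_pos (by linarith) hn0)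
  have hV0 : ∑' k, v k * Real.exp (-1 / n) ^ k ≠ 0 := by
    intro h; rw [h, mul_zero] at h1
    exact inv_ne_zero (show 1 - Real.exp (-1 / n) ≠ 0 by linarith) h1.symm
  have hun := (hu n).ne'
  simp only [id]
  generalize (∑' k, v k * Real.exp (-1 / n) ^ k) = V at hV0 ⊢
  field_simp

/-! ### The transition operator of a branching process with immigration -/

/-- `stepOp μ ν z h` is the expectation of `h` at the next generation, given that the present
generation has `z` individuals. -/
noncomputable def stepOp (μ ν : PMF ℕ) : ℕ → (ℕ → ENNReal) → ENNReal
  | 0, h => ∑' y, ν y * h y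
  | z + 1, h => ∑' j, μ j * stepOp μ ν z fun y => h (j + y)

/-- `weightExp μ ν [h₀, …, hₖ] z` is the expectation of `h₀ (Z 0) * ⋯ * hₖ (Z k)` for the process
started at `Z 0 = z`. -/
noncomputable def weightExp (μ ν : PMF ℕ) : List (ℕ → ENNReal) → ℕ → ENNReal
  | [], _ => 1
  | h :: hs, z => h z * stepOp μ ν z (weightExp μ ν hs)

/-- The weight that kills every nonzero state. -/
def atZero (y : ℕ) : ENNReal := if y = 0 then 1 else 0

/-- The weight that kills the state zero. -/
def offZero (y : ℕ) : ENNReal := if y = 0 then 0 else 1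

/-- The weights encoding that the last zero in `{0, …, m + r}` is `m`. -/
def lastZeroWeights (m r : ℕ) : List (ℕ → ENNReal) :=
  List.replicate m 1 ++ atZero :: List.replicate r offZero

/-- The probability that the process started at `0` avoids `0` at the times `1, …, r`. -/
noncomputable def avoidProb (μ ν : PMF ℕ) (r : ℕ) : ENNReal :=
  stepOp μ ν 0 (weightExp μ ν (List.replicate r offZero))

lemma stepOp_const_mul (μ ν : PMF ℕ) (a : ENNReal) (z : ℕ) (h : ℕ → ENNReal) :
    stepOp μ ν z (fun y => a * h y) = a * stepOp μ ν z h := by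
  induction z generalizing h with
  | zero => simp only [stepOp, ← ENNReal.tsum_mul_left, mul_left_comm]
  | succ z ih =>
    simp only [stepOp, ih fun y => h (_ + y), ← ENNReal.tsum_mul_left, mul_left_comm]

lemma stepOp_add (μ ν : PMF ℕ) (z : ℕ) (h h' : ℕ → ENNReal) :
    stepOp μ ν z (fun y => h y + h' y) = stepOp μ ν z h + stepOp μ ν z h' := by
  induction z generalizing h h' with
  | zero => simp only [stepOp, mul_add, ENNReal.tsum_add]
  | succ z ih => simp only [stepOp, ih (fun y => h (_ + y)), mul_add, ENNReal.tsum_add]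

lemma stepOp_sum (μ ν : PMF ℕ) (z : ℕ) {ι : Type*} (s : Finset ι) (h : ι → ℕ → ENNReal) :
    stepOp μ ν z (fun y => ∑ i ∈ s, h i y) = ∑ i ∈ s, stepOp μ ν z (h i) := by
  classical
  induction s using Finset.induction_on with
  | empty =>
    simpa using stepOp_const_mul μ ν 0 z 0
  | insert i s hi ih =>
    simp only [Finset.sum_insert hi, stepOp_add, ih]

lemma stepOp_one (μ ν : PMF ℕ) (z : ℕ) : stepOp μ ν z (fun _ => 1) = 1 := by
  induction z with
  | zero => simp [stepOp, ν.tsum_coe]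
  | succ z ih => simp [stepOp, ih, μ.tsum_coe]

lemma stepOp_mono (μ ν : PMF ℕ) (z : ℕ) {h h' : ℕ → ENNReal} (hh : ∀ y, h y ≤ h' y) :
    stepOp μ ν z h ≤ stepOp μ ν z h' := by
  induction z generalizing h h' with
  | zero => exact ENNReal.tsum_le_tsum fun y => by gcongr; exact hh y
  | succ z ih => exact ENNReal.tsum_le_tsum fun j => by gcongr; exact ih fun y => hh _

/-- The branching property: `E[s ^ Z 1 | Z 0 = z] = g(s) * f(s) ^ z`. -/
lemma stepOp_pow (μ ν : PMF ℕ) (z : ℕ) (s : ENNReal) :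
    stepOp μ ν z (fun y => s ^ y) = (∑' n, ν n * s ^ n) * (∑' n, μ n * s ^ n) ^ z := by
  induction z with
  | zero => simp [stepOp]
  | succ z ih =>
    simp only [stepOp, pow_add, stepOp_const_mul, ih, ← mul_assoc, ENNReal.tsum_mul_right, pow_one]
    ring

lemma atZero_eq_pow (y : ℕ) : atZero y = 0 ^ y := by
  cases y <;> simp [atZero]

/-- Zero is a regeneration point. -/
lemma weightExp_append_atZero (μ ν : PMF ℕ) (hs tl : List (ℕ → ENNReal)) (z : ℕ) :
    weightExp μ ν (hs ++ atZero :: tl) z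
      = weightExp μ ν (hs ++ [atZero]) z * stepOp μ ν 0 (weightExp μ ν tl) := by
  induction hs generalizing z with
  | nil =>
    rcases Nat.eq_zero_or_pos z with rfl | hz
    · simp only [List.nil_append, weightExp, stepOp_one]
      simp [atZero]
    · simp [weightExp, atZero, hz.ne']
  | cons h hs ih =>
    simp only [List.cons_append, weightExp]
    have : weightExp μ ν (hs ++ atZero :: tl) = fun y => stepOp μ ν 0 (weightExp μ ν tl)
        * weightExp μ ν (hs ++ [atZero]) y := funext fun y => by rw [ih, mul_comm]
    rw [this, stepOp_const_mul]
    ring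

/-- The transition probabilities into `0`: `P(Z m = 0 | Z 0 = z) = fₘ(0) ^ z * ∏ g(fⱼ(0))`. -/
lemma weightExp_replicate_atZero (μ ν : PMF ℕ) (m z : ℕ) :
    weightExp μ ν (List.replicate m 1 ++ [atZero]) z
      = (∏ j ∈ Finset.range m, ∑' n, ν n * ((fun s => ∑' n, μ n * s ^ n)^[j] 0) ^ n)
        * ((fun s => ∑' n, μ n * s ^ n)^[m] 0) ^ z := by
  induction m generalizing z with
  | zero =>
    simp only [List.replicate_zero, List.nil_append, weightExp, stepOp_one]
    simp [atZero_eq_pow]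
  | succ m ih =>
    simp only [List.replicate_succ, List.cons_append, weightExp, Pi.one_apply, one_mul]
    rw [show weightExp μ ν (List.replicate m 1 ++ [atZero]) = _ from funext ih, stepOp_const_mul,
      stepOp_pow, Finset.prod_range_succ, Function.iterate_succ_apply', mul_assoc]

lemma avoidProb_antitone (μ ν : PMF ℕ) : Antitone (avoidProb μ ν) := by
  refine antitone_nat_of_succ_le fun r => stepOp_mono μ ν 0 fun y => ?_
  induction r generalizing y with
  | zero =>
    simp only [zero_add, List.replicate_one, List.replicate_zero, weightExp,
      stepOp_one, mul_one, offZero]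
    split_ifs <;> simp
  | succ r ih =>
    rw [List.replicate_succ, List.replicate_succ (n := r), weightExp, weightExp]
    gcongr
    exact stepOp_mono μ ν y ih

lemma avoidProb_le_one (μ ν : PMF ℕ) (r : ℕ) : avoidProb μ ν r ≤ 1 := by
  refine (avoidProb_antitone μ ν (Nat.zero_le r)).trans (le_of_eq ?_)
  exact stepOp_one μ ν 0

/-- The decomposition of the path up to time `N` at its last zero. -/
lemma sum_weightExp_lastZeroWeights (μ ν : PMF ℕ) (N z : ℕ) :
    ∑ m ∈ Finset.range (N + 1), weightExp μ ν (lastZeroWeights m (N - m)) z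
      + weightExp μ ν (List.replicate (N + 1) offZero) z = 1 := by
  have hz : ∀ y, atZero y + offZero y = 1 := fun y => by
    simp only [atZero, offZero]; split_ifs <;> simp
  induction N generalizing z with
  | zero =>
    simp only [lastZeroWeights, zero_add, Finset.sum_range_one, List.replicate_zero,
      List.nil_append, Nat.sub_zero, List.replicate_one, weightExp, stepOp_one, mul_one, hz]
  | succ N ih =>
    have h1 : ∀ m, weightExp μ ν (lastZeroWeights (m + 1) (N + 1 - (m + 1))) z
        = stepOp μ ν z (weightExp μ ν (lastZeroWeights m (N - m))) := fun m => by
      rw [Nat.add_sub_add_right]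
      simp [lastZeroWeights, List.replicate_succ, weightExp]
    rw [Finset.sum_range_succ', Finset.sum_congr rfl fun m _ => h1 m, add_assoc,
      List.replicate_succ (n := N + 1)]
    simp only [lastZeroWeights, List.replicate_zero, List.nil_append, Nat.sub_zero, weightExp]
    rw [← add_mul, hz, one_mul, ← stepOp_sum, ← stepOp_add]
    exact (congrArg _ (funext ih)).trans (stepOp_one μ ν z)

/-! ### From the Lamperti recursion to the transition operator -/

/-- Independent families of offspring numbers `N i ∼ μ` and immigration numbers `M k ∼ ν`. The flag
`true` marks the offspring numbers in the common index set `Bool × ℕ`. -/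
structure IsBranchingDriver {Ω : Type*} [MeasurableSpace Ω] (P : Measure Ω) (μ ν : PMF ℕ)
    (F : Bool × ℕ → Ω → ℕ) : Prop where
  measurable : ∀ p, Measurable (F p)
  indep : iIndepFun F P
  law_offspring : ∀ i, P.map (F (true, i)) = μ.toMeasure
  law_immigration : ∀ i, P.map (F (false, i)) = ν.toMeasure

/-- The size of the generation after one of size `z`, when the first `c` offspring numbers and the
first `k` immigration numbers have been used up. -/
def nextGen {Ω : Type*} (F : Bool × ℕ → Ω → ℕ) (z c k : ℕ) (ω : Ω) : ℕ :=
  ∑ i ∈ Finset.range z, F (true, c + i) ω + F (false, k) ω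

/-- The product of the weights `hs` along the path driven by `F` from size `z`. -/
noncomputable def pathWeight {Ω : Type*} (F : Bool × ℕ → Ω → ℕ) :
    List (ℕ → ENNReal) → ℕ → ℕ → ℕ → Ω → ENNReal
  | [], _, _, _, _ => 1
  | h :: hs, z, c, k, ω => h z * pathWeight F hs (nextGen F z c k ω) (c + z) (k + 1) ω

/-- The product of the weights `hs` along the sequence `z`. -/
noncomputable def seqWeight : List (ℕ → ENNReal) → (ℕ → ℕ) → ENNReal
  | [], _ => 1
  | h :: hs, z => h (z 0) * seqWeight hs fun i => z (i + 1)

/-- The σ-algebra generated by the variables with index in `S`. -/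
abbrev driverSigma {Ω : Type*} (F : Bool × ℕ → Ω → ℕ) (S : Set (Bool × ℕ)) : MeasurableSpace Ω :=
  ⨆ p ∈ S, MeasurableSpace.comap (F p) ⊤

lemma measurable_driverSigma {Ω : Type*} (F : Bool × ℕ → Ω → ℕ) {S : Set (Bool × ℕ)}
    {p : Bool × ℕ} (hp : p ∈ S) : Measurable[driverSigma F S] (F p) :=
  Measurable.mono (comap_measurable (F p)) (le_iSup₂_of_le p hp le_rfl) le_rfl

lemma measurable_nextGen {Ω : Type*} (F : Bool × ℕ → Ω → ℕ) (z c k : ℕ) {S : Set (Bool × ℕ)}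
    (h1 : ∀ i < z, (true, c + i) ∈ S) (h2 : (false, k) ∈ S) :
    Measurable[driverSigma F S] (nextGen F z c k) := by
  let _ := driverSigma F S
  exact (Finset.measurable_fun_sum _ fun i hi =>
    measurable_driverSigma F (h1 i (Finset.mem_range.1 hi))).add (measurable_driverSigma F h2)

lemma Measurable.apply_nat {Ω : Type*} [MeasurableSpace Ω] {G : ℕ → Ω → ENNReal}
    (hG : ∀ y, Measurable (G y)) {Z : Ω → ℕ} (hZ : Measurable Z) :
    Measurable fun ω => G (Z ω) ω :=
  (measurable_from_prod_countable_right (f := fun p : ℕ × Ω => G p.1 p.2) hG).comp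
    (hZ.prodMk measurable_id)

lemma measurable_pathWeight {Ω : Type*} (F : Bool × ℕ → Ω → ℕ) (hs : List (ℕ → ENNReal))
    (z c k : ℕ) {S : Set (Bool × ℕ)} (h1 : ∀ i, c ≤ i → (true, i) ∈ S)
    (h2 : ∀ i, k ≤ i → (false, i) ∈ S) :
    Measurable[driverSigma F S] (pathWeight F hs z c k) := by
  let _ := driverSigma F S
  induction hs generalizing z c k with
  | nil => exact measurable_const
  | cons h hs ih =>
    exact (Measurable.apply_nat (fun y => ih y (c + z) (k + 1) (fun i hi => h1 i (by omega))
      (fun i hi => h2 i (by omega)))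
      (measurable_nextGen F z c k (fun i _ => h1 _ (by omega)) (h2 k le_rfl))).const_mul _

namespace IsBranchingDriver

variable {Ω : Type*} [MeasurableSpace Ω] {P : Measure Ω} {μ ν : PMF ℕ} {F : Bool × ℕ → Ω → ℕ}

lemma driverSigma_le (hF : IsBranchingDriver P μ ν F) (S : Set (Bool × ℕ)) :
    driverSigma F S ≤ ‹MeasurableSpace Ω› :=
  iSup₂_le fun p _ => (hF.measurable p).comap_le

/-- Conditioning on a discrete variable `Z` that is independent of the family `G`. -/
lemma lintegral_apply (hF : IsBranchingDriver P μ ν F) {S T : Set (Bool × ℕ)} (hST : Disjoint S T)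
    {Z : Ω → ℕ} (hZ : Measurable[driverSigma F S] Z) {G : ℕ → Ω → ENNReal}
    (hG : ∀ y, Measurable[driverSigma F T] (G y)) :
    ∫⁻ ω, G (Z ω) ω ∂P = ∫⁻ ω, (∫⁻ ω', G (Z ω) ω' ∂P) ∂P := by
  have hZm : Measurable Z := hZ.mono (hF.driverSigma_le S) le_rfl
  have hGm : ∀ y, Measurable (G y) := fun y => (hG y).mono (hF.driverSigma_le T) le_rfl
  have hindep : Indep (driverSigma F S) (driverSigma F T) P :=
    indep_iSup_of_disjoint (fun p => (hF.measurable p).comap_le) hF.indep.iIndep hST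
  have key : ∀ H : ℕ → Ω → ENNReal, (∀ y, Measurable (H y)) → ∫⁻ ω, H (Z ω) ω ∂P
      = ∑' y, ∫⁻ ω, (Z ⁻¹' {y}).indicator 1 ω * H y ω ∂P := by
    intro H hH
    have hmeas : ∀ y, AEMeasurable (fun ω => (Z ⁻¹' {y}).indicator 1 ω * H y ω) P := fun y =>
      ((measurable_one.indicator (hZm (measurableSet_singleton y))).mul (hH y)).aemeasurable
    rw [← lintegral_tsum hmeas]
    refine lintegral_congr fun ω => ?_
    rw [tsum_eq_single (Z ω) fun y hy => ?_]
    · rw [Set.indicator_of_mem (by simp), Pi.one_apply, one_mul]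
    · rw [Set.indicator_of_notMem (by simpa using hy.symm), zero_mul]
  rw [key G hGm, key (fun y _ => ∫⁻ ω', G y ω' ∂P) fun y => measurable_const]
  refine tsum_congr fun y => ?_
  have hind : ∀ m : MeasurableSpace Ω, Measurable[m] Z →
      Measurable[m] ((Z ⁻¹' {y}).indicator (1 : Ω → ENNReal)) := fun m hm =>
    measurable_one.indicator (hm (measurableSet_singleton y))
  rw [lintegral_mul_eq_lintegral_mul_lintegral_of_independent_measurableSpace
    (hF.driverSigma_le S) (hF.driverSigma_le T) hindep (hind _ hZ) (hG y), lintegral_mul_const]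
  exact hind _ hZm

lemma lintegral_comp_offspring (hF : IsBranchingDriver P μ ν F) (i : ℕ) (h : ℕ → ENNReal) :
    ∫⁻ ω, h (F (true, i) ω) ∂P = ∑' y, μ y * h y := by
  rw [← lintegral_map (f := h) measurable_from_nat (hF.measurable _), hF.law_offspring,
    lintegral_countable']
  exact tsum_congr fun y => by
    rw [PMF.toMeasure_apply_singleton _ _ (measurableSet_singleton y), mul_comm]

lemma lintegral_comp_immigration (hF : IsBranchingDriver P μ ν F) (i : ℕ) (h : ℕ → ENNReal) :
    ∫⁻ ω, h (F (false, i) ω) ∂P = ∑' y, ν y * h y := by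
  rw [← lintegral_map (f := h) measurable_from_nat (hF.measurable _), hF.law_immigration,
    lintegral_countable']
  exact tsum_congr fun y => by
    rw [PMF.toMeasure_apply_singleton _ _ (measurableSet_singleton y), mul_comm]

lemma lintegral_nextGen (hF : IsBranchingDriver P μ ν F) (z c k : ℕ) (h : ℕ → ENNReal) :
    ∫⁻ ω, h (nextGen F z c k ω) ∂P = stepOp μ ν z h := by
  induction z generalizing h with
  | zero => simpa [nextGen, stepOp] using hF.lintegral_comp_immigration k h
  | succ z ih =>
    have h1 : ∀ ω, nextGen F (z + 1) c k ω = F (true, c + z) ω + nextGen F z c k ω := fun ω => by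
      simp only [nextGen, Finset.sum_range_succ]; ring
    simp only [h1, stepOp]
    rw [hF.lintegral_apply (S := {(true, c + z)}) (T := {(true, c + z)}ᶜ)
      (G := fun j ω => h (j + nextGen F z c k ω)) disjoint_compl_right
      (measurable_driverSigma F (by simp)) fun y => ?_]
    · have ih' : ∀ j, ∫⁻ ω, h (j + nextGen F z c k ω) ∂P = stepOp μ ν z fun y => h (j + y) :=
        fun j => ih fun y => h (j + y)
      simp only [ih']
      exact hF.lintegral_comp_offspring _ fun j => stepOp μ ν z fun y => h (j + y)
    · have hn : Measurable[driverSigma F {(true, c + z)}ᶜ] (nextGen F z c k) :=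
        measurable_nextGen F z c k (fun i hi => by simp; omega) (by simp)
      exact (measurable_from_nat (f := fun n => h (y + n))).comp hn

lemma lintegral_pathWeight (hF : IsBranchingDriver P μ ν F) [IsProbabilityMeasure P]
    (hs : List (ℕ → ENNReal)) (z c k : ℕ) :
    ∫⁻ ω, pathWeight F hs z c k ω ∂P = weightExp μ ν hs z := by
  induction hs generalizing z c k with
  | nil => simp [pathWeight, weightExp]
  | cons h hs ih =>
    -- The next generation uses exactly the variables that the rest of the path does not use.
    let T : Set (Bool × ℕ) := {p | if p.1 then c + z ≤ p.2 else k + 1 ≤ p.2}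
    have hG : ∀ y, Measurable[driverSigma F T] (pathWeight F hs y (c + z) (k + 1)) := fun y =>
      measurable_pathWeight F hs y _ _ (fun i hi => by simpa [T] using hi)
        (fun i hi => by simpa [T] using hi)
    have hZ : Measurable[driverSigma F Tᶜ] (nextGen F z c k) :=
      measurable_nextGen F z c k (fun i hi => by simp [T]; omega) (by simp [T])
    simp only [pathWeight, weightExp]
    rw [lintegral_const_mul, hF.lintegral_apply disjoint_compl_left hZ hG]
    · simp_rw [ih]
      rw [hF.lintegral_nextGen]
    · exact Measurable.apply_nat (fun y => (hG y).mono (hF.driverSigma_le _) le_rfl)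
        (hZ.mono (hF.driverSigma_le _) le_rfl)

end IsBranchingDriver

lemma seqWeight_eq_pathWeight {Ω : Type*} {F : Bool × ℕ → Ω → ℕ} {ω : Ω} {z : ℕ → ℕ}
    (hz : ∀ k, z (k + 1) = nextGen F (z k) (∑ j ∈ Finset.range k, z j) k ω)
    (hs : List (ℕ → ENNReal)) (k : ℕ) :
    seqWeight hs (fun i => z (k + i))
      = pathWeight F hs (z k) (∑ j ∈ Finset.range k, z j) k ω := by
  induction hs generalizing k with
  | nil => rfl
  | cons h hs ih =>
    simp only [seqWeight, pathWeight, add_zero]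
    rw [← hz k, ← Finset.sum_range_succ, ← ih (k + 1)]
    simp only [add_assoc, add_comm 1]

lemma iIndepFun_cond_of_indepFun {Ω β : Type*} [MeasurableSpace Ω] [MeasurableSpace β]
    {P : Measure Ω} [IsProbabilityMeasure P] {f g : Ω → β} (h : IndepFun f g P) :
    iIndepFun (fun (b : Bool) => bif b then f else g) P := by
  rw [iIndepFun_iff_measure_inter_preimage_eq_mul]
  intro S sets hsets
  by_cases h1 : true ∈ S <;> by_cases h2 : false ∈ S
  · have : S = {true, false} := by ext b; cases b <;> simp [h1, h2]
    subst this
    rw [Finset.set_biInter_insert, Finset.set_biInter_singleton, Finset.prod_pair (by simp)]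
    exact h.measure_inter_preimage_eq_mul _ _ (hsets true h1) (hsets false h2)
  · have : S = {true} := by ext b; cases b <;> simp [h1, h2]
    subst this; simp
  · have : S = {false} := by ext b; cases b <;> simp [h1, h2]
    subst this; simp
  · have : S = ∅ := by ext b; cases b <;> simp [h1, h2]
    subst this; simp

lemma IsRandomWalk.measurable_apply {Ω : Type*} [MeasurableSpace Ω] {P : Measure Ω} {p : PMF ℤ}
    {W : Ω → ℕ → ℤ} (h : IsRandomWalk P p W) (n : ℕ) : Measurable fun ω => W ω n :=
  (measurable_pi_apply n).comp h.measurable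

/-- A random walk whose jumps are the values of a distribution `q` on `ℕ` shifted down by `a`:
almost surely the jumps plus `a` are natural numbers, with law `q`. -/
lemma IsRandomWalk.jump_of_map {Ω : Type*} [MeasurableSpace Ω] {P : Measure Ω} {q : PMF ℕ} {a : ℤ}
    {W : Ω → ℕ → ℤ} (h : IsRandomWalk P (q.map fun j : ℕ => (j : ℤ) - a) W) (n : ℕ) :
    (∀ᵐ ω ∂P, (((W ω (n + 1) - W ω n + a).toNat : ℕ) : ℤ) = W ω (n + 1) - W ω n + a) ∧
      P.map (fun ω => (W ω (n + 1) - W ω n + a).toNat) = q.toMeasure := by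
  have hm : Measurable fun ω => W ω (n + 1) - W ω n :=
    (h.measurable_apply _).sub (h.measurable_apply _)
  have hlaw : P.map (fun ω => W ω (n + 1) - W ω n) = q.toMeasure.map fun j : ℕ => (j : ℤ) - a := by
    rw [h.law, PMF.toMeasure_map _ _ measurable_from_nat]
  constructor
  · refine ae_of_ae_map (p := fun x : ℤ => ((x + a).toNat : ℤ) = x + a) hm.aemeasurable ?_
    rw [hlaw]
    refine (ae_map_iff measurable_from_nat.aemeasurable (Set.to_countable _).measurableSet).2
      (Eventually.of_forall fun j => ?_)
    simp
  · have : (fun ω => (W ω (n + 1) - W ω n + a).toNat)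
      = (fun x : ℤ => (x + a).toNat) ∘ fun ω => W ω (n + 1) - W ω n := rfl
    rw [this, ← Measure.map_map (measurable_of_countable _) hm, hlaw,
      Measure.map_map (measurable_of_countable _) measurable_from_nat]
    have : (fun x : ℤ => (x + a).toNat) ∘ (fun j : ℕ => (j : ℤ) - a) = id := by
      ext j; simp
    rw [this, Measure.map_id]

/-- The solution of the Lamperti recursion is a branching process with immigration in the usual
sense: every individual of generation `k` uses its own offspring number. -/
lemma exists_driver_of_lamperti {Ω : Type*} [MeasurableSpace Ω] {P : Measure Ω}
    [IsProbabilityMeasure P] {μ ν : PMF ℕ} {X Y : Ω → ℕ → ℤ} {Z : Ω → ℕ → ℕ}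
    (hX : IsRandomWalk P (μ.map fun j : ℕ => (j : ℤ) - 1) X)
    (hY : IsRandomWalk P (ν.map fun j : ℕ => (j : ℤ)) Y) (hXY : IndepFun X Y P)
    (hZ : ∀ᵐ ω ∂P, SolvesLamperti (X ω) (Y ω) (Z ω)) :
    ∃ F : Bool × ℕ → Ω → ℕ, IsBranchingDriver P μ ν F ∧ ∀ᵐ ω ∂P, Z ω 0 = 0 ∧
      ∀ k, Z ω (k + 1) = nextGen F (Z ω k) (∑ j ∈ Finset.range k, Z ω j) k ω := by
  have hY' : IsRandomWalk P (ν.map fun j : ℕ => (j : ℤ) - 0) Y := by simpa using hY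
  let g : ℤ → (ℕ → ℤ) → ℕ → ℕ := fun a w n => (w (n + 1) - w n + a).toNat
  have hg : ∀ a, Measurable (g a) := fun a => measurable_pi_lambda _ fun n =>
    (measurable_of_countable fun x : ℤ => (x + a).toNat).comp
      ((measurable_pi_apply (n + 1)).sub (measurable_pi_apply n))
  let G : Bool → ℕ → Ω → ℕ := fun b n ω => bif b then g 1 (X ω) n else g 0 (Y ω) n
  have hGm : ∀ b n, Measurable (G b n) := by
    rintro (_ | _) n
    · exact (measurable_pi_apply n).comp ((hg 0).comp hY.measurable)
    · exact (measurable_pi_apply n).comp ((hg 1).comp hX.measurable)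
  have h1 : iIndepFun (fun b ω => (G b · ω)) P := by
    convert! iIndepFun_cond_of_indepFun (hXY.comp (hg 1) (hg 0)) using 1
    funext b ω n
    cases b <;> rfl
  have h2 : ∀ b, iIndepFun (G b) P := by
    rintro (_ | _)
    · exact hY.indep.comp (fun _ x => (x + 0).toNat) fun _ => measurable_of_countable _
    · exact hX.indep.comp (fun _ x => (x + 1).toNat) fun _ => measurable_of_countable _
  refine ⟨fun p => G p.1 p.2, ⟨fun p => hGm _ _, iIndepFun_uncurry' hGm h1 h2,
    fun i => (hX.jump_of_map i).2, fun i => (hY'.jump_of_map i).2⟩, ?_⟩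
  filter_upwards [hZ, hX.zero, hY.zero, ae_all_iff.2 fun i => (hX.jump_of_map i).1,
    ae_all_iff.2 fun i => (hY'.jump_of_map i).1] with ω hL hX0 hY0 hXj hYj
  have hsum : ∀ c z, X ω (c + z) - X ω c = ∑ i ∈ Finset.range z, ((G true (c + i) ω : ℤ) - 1) := by
    intro c z
    induction z with
    | zero => simp
    | succ z ih =>
      rw [Finset.sum_range_succ, ← ih]
      have := hXj (c + z)
      simp only [G, g, cond_true]
      rw [this, ← add_assoc]
      ring
  constructor
  · have := hL 0
    simp only [Finset.range_zero, Finset.sum_empty, hX0, hY0, add_zero] at this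
    exact_mod_cast this
  · intro k
    have e1 := hL (k + 1)
    have e2 := hL k
    have e3 := hsum (∑ j ∈ Finset.range k, Z ω j) (Z ω k)
    have e4 := hYj k
    rw [Finset.sum_range_succ] at e1
    rw [Finset.sum_sub_distrib] at e3
    simp only [Finset.sum_const, Finset.card_range, nsmul_eq_mul, mul_one] at e3
    have e5 : (G false k ω : ℤ) = Y ω (k + 1) - Y ω k + 0 := e4
    zify [nextGen]
    linarith

lemma measurable_seqWeight (hs : List (ℕ → ENNReal)) : Measurable (seqWeight hs) := by
  induction hs with
  | nil => exact measurable_const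
  | cons h hs ih =>
    exact (measurable_from_nat.comp (measurable_pi_apply 0)).mul
      (ih.comp (measurable_pi_lambda _ fun i => measurable_pi_apply (i + 1)))

lemma IsBGWI.lintegral_seqWeight {μ ν : PMF ℕ} {Ω : Type*} [MeasurableSpace Ω] {P : Measure Ω}
    {Z : Ω → ℕ → ℕ} (h : IsBGWI μ ν P Z) (hs : List (ℕ → ENNReal)) :
    ∫⁻ ω, seqWeight hs (Z ω) ∂P = weightExp μ ν hs 0 := by
  obtain ⟨Ω', _, P', X, Y, Z', _, hX, hY, hXY, hL, hid⟩ := h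
  obtain ⟨F, hF, hZ⟩ := exists_driver_of_lamperti hX hY hXY hL
  refine (hid.comp (measurable_seqWeight hs)).lintegral_eq.trans ?_
  rw [← hF.lintegral_pathWeight hs 0 0 0]
  refine lintegral_congr_ae ?_
  filter_upwards [hZ] with ω hω
  have := seqWeight_eq_pathWeight hω.2 hs 0
  simpa [hω.1] using this

lemma seqWeight_lastZeroWeights (m r : ℕ) (z : ℕ → ℕ) :
    seqWeight (lastZeroWeights m r) z
      = {z : ℕ → ℕ | z m = 0 ∧ ∀ j, m < j → j ≤ m + r → z j ≠ 0}.indicator 1 z := by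
  classical
  have hoff : ∀ (r : ℕ) (z : ℕ → ℕ), seqWeight (List.replicate r offZero) z
      = {z : ℕ → ℕ | ∀ j < r, z j ≠ 0}.indicator 1 z := by
    intro r
    induction r with
    | zero => intro z; simp [seqWeight]
    | succ r ih =>
      intro z
      rw [List.replicate_succ, seqWeight, ih]
      simp only [Set.indicator_apply, Set.mem_ofPred_eq, offZero, Pi.one_apply]
      by_cases h0 : z 0 = 0
      · rw [if_pos h0, zero_mul, if_neg fun h => h 0 (Nat.succ_pos r) h0]
      · rw [if_neg h0, one_mul]
        congr 1
        refine propext ⟨fun h j hj => ?_, fun h j hj => h (j + 1) (by omega)⟩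
        cases j with
        | zero => exact h0
        | succ j => exact h j (by omega)
  induction m generalizing z with
  | zero =>
    simp only [lastZeroWeights, List.replicate_zero, List.nil_append, seqWeight, hoff]
    simp only [Set.indicator_apply, Set.mem_ofPred_eq, atZero, Pi.one_apply, zero_add]
    by_cases h0 : z 0 = 0
    · rw [if_pos h0, one_mul]
      congr 1
      refine propext ⟨fun h => ⟨h0, fun j hj hjr => ?_⟩, fun h j hj => h.2 (j + 1) (by omega)
        (by omega)⟩
      obtain ⟨i, rfl⟩ := Nat.exists_eq_succ_of_ne_zero hj.ne'
      exact h i (by omega)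
    · rw [if_neg h0, zero_mul, if_neg fun h => h0 h.1]
  | succ m ih =>
    have : lastZeroWeights (m + 1) r = 1 :: lastZeroWeights m r := by
      simp [lastZeroWeights, List.replicate_succ]
    rw [this, seqWeight, ih, Pi.one_apply, one_mul]
    simp only [Set.indicator_apply, Set.mem_ofPred_eq, Pi.one_apply]
    congr 1
    refine propext (and_congr_right fun _ => ⟨fun h j hj hjr => ?_, fun h j hj hjr =>
      h (j + 1) (by omega) (by omega)⟩)
    obtain ⟨i, rfl⟩ := Nat.exists_eq_succ_of_ne_zero (show j ≠ 0 by omega)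
    exact h i (by omega) (by omega)

lemma measurableSet_lastZero (m N : ℕ) :
    MeasurableSet {z : ℕ → ℕ | z m = 0 ∧ ∀ j, m < j → j ≤ N → z j ≠ 0} := by
  have : {z : ℕ → ℕ | z m = 0 ∧ ∀ j, m < j → j ≤ N → z j ≠ 0}
      = (fun z => z m) ⁻¹' {0} ∩ ⋂ j, ⋂ (_ : m < j), ⋂ (_ : j ≤ N), (fun z => z j) ⁻¹' {0}ᶜ := by
    ext z; simp
  rw [this]
  exact (measurable_pi_apply m (measurableSet_singleton 0)).inter
    (MeasurableSet.iInter fun j => MeasurableSet.iInter fun _ => MeasurableSet.iInter fun _ =>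
      measurable_pi_apply j (measurableSet_singleton 0).compl)

/-- The law of the last zero of the chain before time `m + r`. -/
lemma IsBGWI.measure_lastZero {μ ν : PMF ℕ} {Ω : Type*} [MeasurableSpace Ω] {P : Measure Ω}
    {Z : Ω → ℕ → ℕ} (h : IsBGWI μ ν P Z) (m r : ℕ) :
    P {ω | Z ω m = 0 ∧ ∀ j, m < j → j ≤ m + r → Z ω j ≠ 0}
      = weightExp μ ν (List.replicate m 1 ++ [atZero]) 0 * avoidProb μ ν r := by
  have h1 := h.lintegral_seqWeight (lastZeroWeights m r)
  obtain ⟨_, _, _, _, _, _, _, _, _, _, _, hid⟩ := h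
  simp_rw [seqWeight_lastZeroWeights] at h1
  have hm := measurableSet_lastZero m (m + r)
  rw [show weightExp μ ν (lastZeroWeights m r) 0
    = weightExp μ ν (List.replicate m 1 ++ [atZero]) 0 * avoidProb μ ν r from
    weightExp_append_atZero μ ν _ _ 0] at h1
  rw [← h1]
  have hnull : NullMeasurableSet {ω | Z ω m = 0 ∧ ∀ j, m < j → j ≤ m + r → Z ω j ≠ 0} P :=
    hid.aemeasurable_fst.nullMeasurableSet_preimage hm
  rw [← lintegral_indicator_one₀ hnull]
  rfl

/-! ### The renewal pair of the chain -/

lemma tsum_mul_pow_ofReal (p : PMF ℕ) {s : ℝ} (hs : s ∈ Set.Icc (0 : ℝ) 1) :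
    ∑' n, p n * ENNReal.ofReal s ^ n = ENNReal.ofReal (genFun p s) := by
  rw [genFun, ENNReal.ofReal_tsum_of_nonneg
    (fun n => mul_nonneg (pow_nonneg hs.1 n) ENNReal.toReal_nonneg) (summable_genFun p hs)]
  refine tsum_congr fun n => ?_
  rw [ENNReal.ofReal_mul (pow_nonneg hs.1 n), ENNReal.ofReal_pow hs.1,
    ENNReal.ofReal_toReal (p.apply_ne_top n), mul_comm]

/-- The probability `∏ g(fⱼ(0))` that the chain started at `0` is at `0` at time `m`. -/
noncomputable def zeroProb (μ ν : PMF ℕ) (m : ℕ) : ℝ :=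
  ∏ j ∈ Finset.range m, genFun ν ((genFun μ)^[j] 0)

section

variable {μ ν : PMF ℕ} {α c d : ℝ} {l k : ℝ → ℝ}

lemma AssumptionSL.weightExp_eq_zeroProb (h : AssumptionSL μ ν α c d l k) (m : ℕ) :
    weightExp μ ν (List.replicate m 1 ++ [atZero]) 0 = ENNReal.ofReal (zeroProb μ ν m) := by
  have hit : ∀ j, (fun s => ∑' n, μ n * s ^ n)^[j] 0 = ENNReal.ofReal ((genFun μ)^[j] 0) := by
    intro j
    induction j with
    | zero => simp
    | succ j ih =>
      rw [Function.iterate_succ_apply', Function.iterate_succ_apply', ih,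
        tsum_mul_pow_ofReal μ (h.iterate_mem j)]
  rw [weightExp_replicate_atZero, pow_zero, mul_one, zeroProb, ENNReal.ofReal_prod_of_nonneg]
  · exact Finset.prod_congr rfl fun j _ => by rw [hit, tsum_mul_pow_ofReal ν (h.iterate_mem j)]
  · exact fun j _ => ENNReal.toReal_nonneg.trans (genFun_mem_Icc ν (h.iterate_mem j)).1

lemma AssumptionSL.genFun_iterate_pos (h : AssumptionSL μ ν α c d l k) (hν : 0 < ν 0) (j : ℕ) :
    0 < genFun ν ((genFun μ)^[j] 0) :=
  (ENNReal.toReal_pos hν.ne' (ν.apply_ne_top 0)).trans_le (genFun_mem_Icc ν (h.iterate_mem j)).1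

lemma AssumptionSL.zeroProb_pos (h : AssumptionSL μ ν α c d l k) (hν : 0 < ν 0) (m : ℕ) :
    0 < zeroProb μ ν m :=
  Finset.prod_pos fun j _ => h.genFun_iterate_pos hν j

lemma AssumptionSL.zeroProb_antitone (h : AssumptionSL μ ν α c d l k) (hν : 0 < ν 0) :
    Antitone (zeroProb μ ν) :=
  antitone_nat_of_succ_le fun m => by
    rw [zeroProb, Finset.prod_range_succ]
    exact mul_le_of_le_one_right (h.zeroProb_pos hν m).le (genFun_mem_Icc ν (h.iterate_mem m)).2

lemma AssumptionSL.normalizedRegVar_zeroProb (h : AssumptionSL μ ν α c d l k) (hν : 0 < ν 0) :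
    NormalizedRegVar (zeroProb μ ν) (-(d / (α * c))) :=
  normalizedRegVar_of_tendsto (h.zeroProb_pos hν) (h.genFun_iterate_pos hν)
    (fun _ => Finset.prod_range_succ _ _) h.tendsto_mul_one_sub_genFun_iterate

lemma AssumptionSL.renewal (h : AssumptionSL μ ν α c d l k) (hν : 0 < ν 0) (N : ℕ) :
    ∑ m ∈ Finset.range (N + 1), zeroProb μ ν m * (avoidProb μ ν (N - m)).toReal = 1 := by
  have h1 := sum_weightExp_lastZeroWeights μ ν N 0
  have h2 : weightExp μ ν (List.replicate (N + 1) offZero) 0 = 0 := by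
    simp [List.replicate_succ, weightExp, offZero]
  rw [h2, add_zero] at h1
  have h3 : ∀ m, weightExp μ ν (lastZeroWeights m (N - m)) 0
      = ENNReal.ofReal (zeroProb μ ν m) * avoidProb μ ν (N - m) := fun m => by
    rw [← h.weightExp_eq_zeroProb]
    exact weightExp_append_atZero μ ν _ _ 0
  simp_rw [h3] at h1
  have hfin : ∀ r, avoidProb μ ν r ≠ ⊤ := fun r =>
    ((avoidProb_le_one μ ν r).trans_lt ENNReal.one_lt_top).ne
  have h4 := congrArg ENNReal.toReal h1
  rw [ENNReal.toReal_sum fun m _ => ENNReal.mul_ne_top ENNReal.ofReal_ne_top (hfin _),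
    ENNReal.toReal_one] at h4
  rw [← h4]
  refine Finset.sum_congr rfl fun m _ => ?_
  rw [ENNReal.toReal_mul, ENNReal.toReal_ofReal (h.zeroProb_pos hν m).le]

lemma AssumptionSL.measureReal_lastZero (h : AssumptionSL μ ν α c d l k) (hν : 0 < ν 0)
    {Ω : Type*} [MeasurableSpace Ω] {P : Measure Ω} {Z : Ω → ℕ → ℕ} (hZ : IsBGWI μ ν P Z)
    {m N : ℕ} (hmN : m ≤ N) :
    P.real {ω | Z ω m = 0 ∧ ∀ j, m < j → j ≤ N → Z ω j ≠ 0}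
      = zeroProb μ ν m * (avoidProb μ ν (N - m)).toReal := by
  have h1 := hZ.measure_lastZero m (N - m)
  rw [Nat.add_sub_cancel' hmN] at h1
  rw [measureReal_def, h1, h.weightExp_eq_zeroProb, ENNReal.toReal_mul,
    ENNReal.toReal_ofReal (h.zeroProb_pos hν m).le]

end

/-! ### The last zero of the rescaled path -/

lemma floor_mul_natCast_div {n : ℕ} (hn : 1 ≤ n) (j : ℕ) :
    ⌊(n : ℝ≥0) * ((j : ℝ≥0) / n)⌋₊ = j := by
  have : (n : ℝ≥0) ≠ 0 := by exact_mod_cast (by omega : n ≠ 0)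
  rw [mul_div_cancel₀ _ this, Nat.floor_natCast]

/-- A right-continuous path which is a step function with mesh `1 / n` on a dense set is one
everywhere. -/
lemma IsCadlagPath.eq_floor {z : ℝ≥0 → ℝ} (hz : IsCadlagPath z) {n : ℕ} (hn : 1 ≤ n)
    {D : Set ℝ≥0} (hD : Dense D) (hzD : ∀ u ∈ D, z u = z (⌊(n : ℝ≥0) * u⌋₊ / n)) (u : ℝ≥0) :
    z u = z (⌊(n : ℝ≥0) * u⌋₊ / n) := by
  have hn0 : (0 : ℝ≥0) < n := by exact_mod_cast hn
  have hlim : Tendsto z (𝓝[>] u) (𝓝 (z u)) :=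
    ((hz u).1.mono Set.Ioi_subset_Ici_self).tendsto
  have hlt : u < (⌊(n : ℝ≥0) * u⌋₊ + 1) / n := by
    rw [lt_div_iff₀ hn0, mul_comm]; exact Nat.lt_floor_add_one _
  have hfreq : ∃ᶠ w in 𝓝[>] u, z w ∈ ({z (⌊(n : ℝ≥0) * u⌋₊ / n)} : Set ℝ) := by
    rw [(nhdsGT_basis u).frequently_iff]
    intro e he
    obtain ⟨w, hwD, hw1, hw2⟩ := hD.exists_between (lt_min he hlt)
    refine ⟨w, ⟨hw1, hw2.trans_le (min_le_left _ _)⟩, ?_⟩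
    have hw3 := hw2.trans_le (min_le_right _ _)
    rw [lt_div_iff₀ hn0, mul_comm] at hw3
    have : ⌊(n : ℝ≥0) * w⌋₊ = ⌊(n : ℝ≥0) * u⌋₊ :=
      (Nat.floor_eq_iff zero_le).2
        ⟨(Nat.floor_le zero_le).trans (by gcongr), hw3⟩
    rw [Set.mem_singleton_iff, hzD w hwD, this]
  exact isClosed_singleton.mem_of_frequently_of_tendsto hfreq hlim

/-- The zero at time `m` of the chain occupies the interval `[m / n, (m + 1) / n)` of rescaled
time, so a last zero at `m` is seen as `g_t = (m + 1) / n`. -/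
lemma lastZero_eq_iff {z : ℝ≥0 → ℝ} {n : ℕ} (hn : 1 ≤ n)
    (hz : ∀ u, z u = z (⌊(n : ℝ≥0) * u⌋₊ / n)) {t : ℝ≥0} {m : ℕ}
    (hmt : ((m : ℝ≥0) + 1) / n < t) :
    lastZero t z = (m + 1) / n ↔
      z ((m : ℝ≥0) / n) = 0 ∧ ∀ j : ℕ, m < j → j ≤ ⌊(n : ℝ≥0) * t⌋₊ → z ((j : ℝ≥0) / n) ≠ 0 := by
  have hn0 : (0 : ℝ≥0) < n := by exact_mod_cast hn
  have hmem : ∀ (j : ℕ) (u : ℝ≥0), (j : ℝ≥0) / n ≤ u → u < (j + 1) / n → ⌊(n : ℝ≥0) * u⌋₊ = j := by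
    intro j u h1 h2
    rw [div_le_iff₀ hn0] at h1
    rw [lt_div_iff₀ hn0] at h2
    exact (Nat.floor_eq_iff zero_le).2 ⟨by rwa [mul_comm], by rwa [mul_comm]⟩
  have hltsucc : ∀ j : ℕ, (j : ℝ≥0) / n < (j + 1) / n := fun j =>
    div_lt_div_of_pos_right (lt_add_one _) hn0
  have hbdd : BddAbove {u : ℝ≥0 | u ≤ t ∧ z u = 0} := ⟨t, fun u hu => hu.1⟩
  constructor
  · intro h
    have hno : ∀ j : ℕ, m < j → j ≤ ⌊(n : ℝ≥0) * t⌋₊ → z ((j : ℝ≥0) / n) ≠ 0 := by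
      intro j hmj hjt h0
      have hmj' : ((m : ℝ≥0) + 1) / n ≤ j / n := by
        gcongr; exact_mod_cast hmj
      have hjt' : (j : ℝ≥0) / n ≤ t := by
        rw [div_le_iff₀ hn0, mul_comm]
        exact (Nat.cast_le.2 hjt).trans (Nat.floor_le zero_le)
      -- some zero lies strictly to the right of `(m + 1) / n`
      obtain ⟨u, hu1, hu2, hu3, hu4⟩ : ∃ u, ((m : ℝ≥0) + 1) / n < u ∧ (j : ℝ≥0) / n ≤ u ∧
          u < (j + 1) / n ∧ u ≤ t := by
        rcases hmj'.eq_or_lt with he | hlt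
        · obtain ⟨u, hu1, hu2⟩ := exists_between (lt_min hmt (he ▸ hltsucc j))
          exact ⟨u, hu1, he ▸ hu1.le, hu2.trans_le (min_le_right _ _),
            (hu2.trans_le (min_le_left _ _)).le⟩
        · exact ⟨_, hlt, le_rfl, hltsucc j, hjt'⟩
      have : u ≤ lastZero t z := le_csSup hbdd ⟨hu4, by rw [hz, hmem j u hu2 hu3, h0]⟩
      rw [h] at this
      exact absurd hu1 this.not_gt
    refine ⟨?_, hno⟩
    by_contra h0
    have hle : lastZero t z ≤ m / n := by
      refine csSup_le' fun u hu => ?_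
      have h1 : z ((⌊(n : ℝ≥0) * u⌋₊ : ℝ≥0) / n) = 0 := by rw [← hz]; exact hu.2
      have h2 : ⌊(n : ℝ≥0) * u⌋₊ ≤ m := by
        by_contra! h3
        exact hno _ h3 (Nat.floor_mono (by gcongr; exact hu.1)) h1
      have h3 : ⌊(n : ℝ≥0) * u⌋₊ < m := h2.lt_of_ne fun h => h0 (by rw [← h]; exact h1)
      rw [le_div_iff₀ hn0, mul_comm]
      exact ((Nat.floor_lt zero_le).1 h3).le
    rw [h] at hle
    exact absurd (hltsucc m) hle.not_gt
  · rintro ⟨h0, hno⟩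
    refine le_antisymm (csSup_le' fun u hu => ?_) ?_
    · have h1 : z ((⌊(n : ℝ≥0) * u⌋₊ : ℝ≥0) / n) = 0 := by rw [← hz]; exact hu.2
      have h2 : ⌊(n : ℝ≥0) * u⌋₊ ≤ m := by
        by_contra! h3
        exact hno _ h3 (Nat.floor_mono (by gcongr; exact hu.1)) h1
      rw [le_div_iff₀ hn0, mul_comm]
      exact (Nat.lt_floor_add_one _).le.trans (by gcongr)
    · refine le_of_forall_lt fun w hw => ?_
      obtain ⟨u, hu1, hu2⟩ := exists_between (max_lt hw (hltsucc m))
      refine ((le_max_left _ _).trans_lt hu1).trans_le (le_csSup hbdd ⟨(hu2.trans hmt).le, ?_⟩)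
      rw [hz, hmem m u ((le_max_right _ _).trans hu1.le) hu2, h0]

/-- The law of `g_t` for the rescaled process, in terms of the chain. -/
lemma measureReal_lastZero_eq {Ω₁ Ω : Type*} [MeasurableSpace Ω₁] [MeasurableSpace Ω]
    {P₁ : Measure Ω₁} {P : Measure Ω} {Z₁ : Ω₁ → ℕ → ℕ} {Z : Ω → ℝ≥0 → ℝ} {n : ℕ} (hn : 1 ≤ n)
    {b : ℝ} (hb : b ≠ 0) (hcad : ∀ᵐ ω ∂P, IsCadlagPath (Z ω))
    (hid : IdentDistrib Z (fun ω u => (Z₁ ω ⌊(n : ℝ≥0) * u⌋₊ : ℝ) / b) P P₁)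
    {t : ℝ≥0} {m : ℕ} (hmt : ((m : ℝ≥0) + 1) / n < t) :
    P.real {ω | lastZero t (Z ω) = (m + 1) / n}
      = P₁.real {ω | Z₁ ω m = 0 ∧ ∀ j, m < j → j ≤ ⌊(n : ℝ≥0) * t⌋₊ → Z₁ ω j ≠ 0} := by
  obtain ⟨D, hDc, hD⟩ := TopologicalSpace.exists_countable_dense ℝ≥0
  have hstep : ∀ᵐ ω ∂P, ∀ u ∈ D, Z ω u = Z ω (⌊(n : ℝ≥0) * u⌋₊ / n) := by
    refine hid.symm.ae_snd (p := fun z : ℝ≥0 → ℝ => ∀ u ∈ D, z u = z (⌊(n : ℝ≥0) * u⌋₊ / n)) ?_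
      (Eventually.of_forall fun ω u _ => by simp only [floor_mul_natCast_div hn])
    have : {z : ℝ≥0 → ℝ | ∀ u ∈ D, z u = z (⌊(n : ℝ≥0) * u⌋₊ / n)}
        = ⋂ u ∈ D, {z | z u = z (⌊(n : ℝ≥0) * u⌋₊ / n)} := by ext; simp
    rw [this]
    exact MeasurableSet.biInter hDc fun u _ =>
      measurableSet_eq_fun (measurable_pi_apply u) (measurable_pi_apply _)
  let S : Set (ℝ≥0 → ℝ) := {z | z ((m : ℝ≥0) / n) = 0 ∧
    ∀ j : ℕ, m < j → j ≤ ⌊(n : ℝ≥0) * t⌋₊ → z ((j : ℝ≥0) / n) ≠ 0}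
  have hS : MeasurableSet S := by
    have : S = (fun z => z ((m : ℝ≥0) / n)) ⁻¹' {0} ∩ ⋂ (j : ℕ), ⋂ (_ : m < j),
        ⋂ (_ : j ≤ ⌊(n : ℝ≥0) * t⌋₊), (fun z => z ((j : ℝ≥0) / n)) ⁻¹' {0}ᶜ := by
      ext z; simp [S]
    rw [this]
    exact (measurable_pi_apply _ (measurableSet_singleton 0)).inter
      (MeasurableSet.iInter fun j => MeasurableSet.iInter fun _ => MeasurableSet.iInter fun _ =>
        measurable_pi_apply _ (measurableSet_singleton 0).compl)
  have h1 : {ω | lastZero t (Z ω) = (m + 1) / n} =ᵐ[P] Z ⁻¹' S := by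
    filter_upwards [hcad, hstep] with ω hc hω
    exact propext (lastZero_eq_iff hn (hc.eq_floor hn hD hω) hmt)
  rw [measureReal_congr h1, measureReal_def, hid.measure_mem_eq hS, measureReal_def]
  congr 2
  ext ω
  simp only [S, Set.mem_preimage, Set.mem_ofPred_eq, floor_mul_natCast_div hn, ne_eq,
    div_eq_zero_iff, hb, or_false, Nat.cast_eq_zero]

theorem corollary9
    (μ ν : PMF ℕ) (hμ : μ 1 < 1) (hν : 0 < ν 0)
    (α c d : ℝ) (l k : ℝ → ℝ) (hSL : AssumptionSL μ ν α c d l k)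
    (δ : ℝ) (hδ : δ = d / (α * c)) (hδ_mem : δ ∈ Set.Ioo (0 : ℝ) 1)
    (b : ℕ → ℝ) (hb : IsScalingSequence α l b)
    {Ω₁ : Type*} [MeasurableSpace Ω₁] (P₁ : Measure Ω₁) [IsProbabilityMeasure P₁]
    (Z₁ : Ω₁ → ℕ → ℕ) (hZ₁ : IsBGWI μ ν P₁ Z₁)
    {Ω : ℕ → Type*} [∀ n, MeasurableSpace (Ω n)]
    (P : ∀ n, Measure (Ω n)) [∀ n, IsProbabilityMeasure (P n)]
    (Z : ∀ n, Ω n → ℝ≥0 → ℝ)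
    (hZ_cadlag : ∀ n, 1 ≤ n → ∀ᵐ ω ∂(P n), IsCadlagPath (Z n ω))
    (hZ_law : ∀ n, 1 ≤ n →
      IdentDistrib (Z n) (fun ω u => (Z₁ ω ⌊(n : ℝ≥0) * u⌋₊ : ℝ) / b n) (P n) P₁)
    (t s : ℝ≥0) (hs_pos : 0 < s) (hs_lt : s < t)
    (sn : ℕ → ℝ≥0) (hsn_nat : ∀ n : ℕ, 1 ≤ n → ∃ m : ℕ, (n : ℝ≥0) * sn n = m)
    (hsn : Tendsto sn atTop (𝓝 s)) :
    (fun n : ℕ => (P n).real {ω | lastZero t (Z n ω) = sn n}) ~[atTop]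
      fun n : ℕ => (1 / (n : ℝ)) *
        (1 / (Real.Gamma δ * Real.Gamma (1 - δ) * (s : ℝ) ^ δ * ((t : ℝ) - (s : ℝ)) ^ (1 - δ))) := by

  have hδ' := hδ ▸ hSL.normalizedRegVar_zeroProb hν
  have hts : 0 < (t : ℝ) - s := sub_pos.2 hs_lt
  -- A last zero of the chain at time `m n` is seen by `Z n` as `g_t = (m n + 1) / n = sn n`.
  let m : ℕ → ℕ := fun n => ⌊(n : ℝ≥0) * sn n⌋₊ - 1
  let K : ℕ → ℕ := fun n => ⌊(n : ℝ≥0) * t⌋₊ - m n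
  have hev : ∀ᶠ n in atTop, 1 ≤ n ∧ 0 < b n ∧ sn n < t ∧ sn n = ((m n : ℝ≥0) + 1) / n := by
    filter_upwards [eventually_ge_atTop 1, hb.tendsto_atTop.eventually_gt_atTop 0,
      hsn.eventually_lt_const hs_lt, hsn.eventually_const_lt hs_pos] with n hn hbn hlt hpos
    refine ⟨hn, hbn, hlt, ?_⟩
    have hn0 : (0 : ℝ≥0) < n := by exact_mod_cast hn
    obtain ⟨M, hM⟩ := hsn_nat n hn
    have hM0 : 1 ≤ M := by
      have : (0 : ℝ≥0) < M := hM ▸ mul_pos hn0 hpos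
      exact_mod_cast this
    have : m n + 1 = M := by simp only [m, hM, Nat.floor_natCast]; omega
    rw [eq_div_iff hn0.ne', mul_comm, hM, ← this]
    push_cast; rfl
  have hsn' : Tendsto (fun n => (sn n : ℝ)) atTop (𝓝 s) := NNReal.tendsto_coe.2 hsn
  have hm : Tendsto (fun n => (m n : ℝ) / n) atTop (𝓝 s) := by
    have h1 := hsn'.sub (tendsto_one_div_atTop_nhds_zero_nat (𝕜 := ℝ))
    rw [sub_zero] at h1
    refine h1.congr' ?_
    filter_upwards [hev] with n ⟨_, _, _, h⟩
    rw [h]; push_cast; ring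
  have hmN : ∀ᶠ n in atTop, m n ≤ ⌊(n : ℝ≥0) * t⌋₊ := by
    filter_upwards [hev] with n ⟨hn, _, hlt, h⟩
    have hn0 : (0 : ℝ≥0) < n := by exact_mod_cast hn
    rw [h, div_lt_iff₀ hn0, mul_comm] at hlt
    exact Nat.le_floor (le_self_add.trans hlt.le)
  have hK : Tendsto (fun n => (K n : ℝ) / n) atTop (𝓝 ((t : ℝ) - s)) := by
    have h1 : Tendsto (fun n : ℕ => (⌊(t : ℝ) * n⌋₊ : ℝ) / n) atTop (𝓝 t) :=
      (tendsto_nat_floor_mul_div_atTop t.coe_nonneg).comp (tendsto_natCast_atTop_atTop (R := ℝ))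
    refine (h1.sub hm).congr' ?_
    filter_upwards [hmN] with n hn
    have h2 : ⌊(t : ℝ) * n⌋₊ = ⌊(n : ℝ≥0) * t⌋₊ := by
      rw [mul_comm (n : ℝ≥0)]
      exact_mod_cast Nonneg.nat_floor_coe (t * (n : ℝ≥0))
    rw [h2, ← sub_div, ← Nat.cast_sub hn]
  have hfin : ∀ r, avoidProb μ ν r ≠ ⊤ := fun r =>
    ((avoidProb_le_one μ ν r).trans_lt ENNReal.one_lt_top).ne
  have hmain := tendsto_mul_of_renewal hδ_mem hδ' (hSL.zeroProb_pos hν) (hSL.zeroProb_antitone hν)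
    (v := fun r => (avoidProb μ ν r).toReal) (fun r => ENNReal.toReal_nonneg)
    (fun i j hij => ENNReal.toReal_mono (hfin i) (avoidProb_antitone μ ν hij)) (hSL.renewal hν)
    (NNReal.coe_pos.2 hs_pos) hts hm hK
  have hne : 1 / (Real.Gamma δ * Real.Gamma (1 - δ) * (s : ℝ) ^ δ * ((t : ℝ) - s) ^ (1 - δ))
      ≠ 0 := by
    have := Real.Gamma_pos_of_pos hδ_mem.1
    have := Real.Gamma_pos_of_pos (sub_pos.2 hδ_mem.2)
    have := NNReal.coe_pos.2 hs_pos
    positivity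
  refine ((IsEquivalent.refl (u := fun n : ℕ => 1 / (n : ℝ))).mul
    ((isEquivalent_const_iff_tendsto hne).2 hmain)).congr_left ?_
  filter_upwards [hev, hmN] with n ⟨hn, hbn, hlt, h⟩ hmn
  have hn0 : (n : ℝ) ≠ 0 := by exact_mod_cast (by omega : n ≠ 0)
  rw [h] at hlt
  rw [h, measureReal_lastZero_eq hn hbn.ne' (hZ_cadlag n hn) (hZ_law n hn) hlt,
    hSL.measureReal_lastZero hν hZ₁ hmn]
  simp only [Pi.mul_apply, K]
  field_simp
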